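/- Let $n\ge 1$ and $f(x)=x^TAx+2a^Tx+\alpha$ with $A\in\mathbb{R}^{n\times n}$ symmetric, $a\in\mathbb{R}^n$, $\alpha\in\mathbb{R}$. Let $V=\{x\in\mathbb{R}^n: f(x)=0\}$ and let $V_{\mathbb{C}}\subset\mathbb{C}^n$ be the complex zero set of $f$. The ED SDP-exact region is $$\mathcal{R}=\{u\in\mathbb{R}^n:\ \text{there are } x\in V,\ \lambda\in\mathbb{R} \text{ with } I-\lambda A\succ 0 \text{ and } -u-\lambda a+(I-\lambda A)x=0\}.$$ Let $S=\{\lambda\in\mathbb{R}: I-\lambda A\succ0\}$ and $D=\{\lambda\in\mathbb{C}:\det(I-\lambda A)=0\}$. Let $K$ be the field generated over $\mathbb{Q}$ by the coefficients of $f$ (the entries of $A$, $a$, $\alpha$). The algebraic boundaries $\partial_{\rm alg}\mathcal{R}\subset\mathbb{C}^n$ and $\partial_{\rm alg}S\subset\mathbb{C}$ are the Zariski closures over $K$ of the topological boundaries: the sets of complex points at which every polynomial with coefficients in $K$ that vanishes on $\partial\mathcal{R}$ (respectively $\partial S$) vanishes. Let $\pi(x,\lambda)=x-\lambda(a+Ax)$.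 The degree of $\pi$ on a set is the cardinality of its fibre over a generic point of the image (a point outside the zero set of some polynomial, where the remaining points are Zariski dense in the image). The cut locus ${\rm Cut}(V)$ is the set of points of $\mathbb{R}^n$ that have at least two nearest points on $V$. **Density.** If $V$ contains a point at which $\nabla f\neq0$, then $\mathcal{R}$ is dense in $\mathbb{R}^n$. **Generic quadrics.** For each $n$ there is a nonzero polynomial $P$ over $\mathbb{Q}$ in the coefficients of $f$ such that the following holds for every $f$ with $P(f)\ne0$ and $V\neq\emptyset$. 1. $\mathcal{R}$ is dense in $\mathbb{R}^n$ and $\partial\mathcal{R}=\mathbb{R}^n\setminus\mathcal{R}$. 2. $\pi$ has degree $2$ on $V_{\mathbb{C}}\times\partial_{\rm alg}S$, and also on $V_{\mathbb{C}}\times D$. 3. There are $n$ distinct hyperplanes $H_1,\dots,H_n$ with real equations such that $\pi(V_{\mathbb{C}}\times D)$ is the union of their complexifications. If the coefficients of $f$ are moreover algebraically independent over $\mathbb{Q}$, then $\partial_{\rm alg}S=D$, and $\partial_{\rm alg}\mathcal{R}$ is the union of these $n$ complex hyperplanes. 4. If $V$ is an ellipsoid, then for some $i$ the set $\partial\mathcal{R}$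 is a (closed) solid ellipsoid in $H_i$, and ${\rm Cut}(V)$ is its relative interior. 5. If $V$ is not an ellipsoid, then there are $i\neq j$ such that $\partial\mathcal{R}$ is the disjoint union of two sets $B_i\subset H_i$ and $B_j\subset H_j$. For $k\in\{i,j\}$ the set $B_k$ affinely spans $H_k$ and is bounded by a quadric: $B_k=\{u\in H_k: g_k(u)\le0\}$ for a polynomial $g_k$ whose restriction to $H_k$ has degree two, and the boundary of $B_k$ relative to $H_k$ is $\{u\in H_k:g_k(u)=0\}$. Moreover ${\rm Cut}(V)$ is the union of the relative interiors of $B_i$ and $B_j$. 6. $\partial\mathcal{R}$ is the closure of ${\rm Cut}(V)$. -/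

import Mathlib

open scoped Matrix

noncomputable section

namespace EDQuadric

/-- The coefficients of a polynomial of degree at most two in `n` variables
`f(x) = xᵀ A x + 2 aᵀ x + α`, stored as the entries of the symmetric matrix
`[[α, aᵀ], [a, A]]`, whose rows and columns are indexed by `0, …, n`. -/
abbrev Coeffs (n : ℕ) (R : Type*) : Type _ := Sym2 (Fin (n + 1)) → R

/-- The symmetric `n × n` matrix `A`. -/
def matA {n : ℕ} {R : Type*} (q : Coeffs n R) : Matrix (Fin n) (Fin n) R :=
  Matrix.of fun i j => q s(i.succ, j.succ)

/-- The vector `a`. -/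
def vecA {n : ℕ} {R : Type*} (q : Coeffs n R) : Fin n → R := fun i => q s(0, i.succ)

/-- The value `f(x) = xᵀ A x + 2 aᵀ x + α`. -/
def quad {n : ℕ} {R : Type*} [CommRing R] (q : Coeffs n R) (x : Fin n → R) : R :=
  x ⬝ᵥ (matA q *ᵥ x) + 2 * (vecA q ⬝ᵥ x) + q s(0, 0)

/-- Half of the gradient of `f` at `x`, that is `a + A x`. -/
def halfGrad {n : ℕ} {R : Type*} [CommRing R] (q : Coeffs n R) (x : Fin n → R) : Fin n → R :=
  vecA q + matA q *ᵥ x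

/-- The same coefficients, viewed as complex numbers. -/
def toComplex {n : ℕ} (q : Coeffs n ℝ) : Coeffs n ℂ := fun e => (q e : ℂ)

/-- The real quadric `V_f`. -/
def realV {n : ℕ} (q : Coeffs n ℝ) : Set (EuclideanSpace ℝ (Fin n)) :=
  {x | quad q x.ofLp = 0}

/-- The complex quadric with the same equation. -/
def complexV {n : ℕ} (q : Coeffs n ℝ) : Set (Fin n → ℂ) :=
  {z | quad (toComplex q) z = 0}

/-- The objective function with symmetric matrix `C` and linear part `2 cᵀ x` belongs to the
SDP-exact region of `f`: for some `x ∈ V_f` and some multiplier `l`, the Hessian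
`H(l) = C - l A` of the Lagrangian is positive definite and `c - l a + H(l) x = 0`. -/
def IsSDPExact {n : ℕ} (q : Coeffs n ℝ) (C : Matrix (Fin n) (Fin n) ℝ) (c : Fin n → ℝ) : Prop :=
  ∃ x ∈ realV q, ∃ l : ℝ,
    (C - l • matA q).PosDef ∧ c - l • vecA q + (C - l • matA q) *ᵥ x.ofLp = 0

/-- The SDP-exact region for the Euclidean distance problem: the points `u` whose objective
function `‖x - u‖² - ‖u‖² = xᵀ I x + 2 (-u)ᵀ x` lies in the SDP-exact region. -/
def edRegion {n : ℕ} (q : Coeffs n ℝ) : Set (EuclideanSpace ℝ (Fin n)) :=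
  {u | IsSDPExact q 1 (-u.ofLp)}

/-- The master spectrahedron of the Euclidean distance problem. -/
def masterSpec {n : ℕ} (q : Coeffs n ℝ) : Set ℝ :=
  {l | ((1 : Matrix (Fin n) (Fin n) ℝ) - l • matA q).PosDef}

/-- The field generated over `ℚ` by the coefficients of `f`, as a subfield of `ℂ`. -/
def coeffField {n : ℕ} (q : Coeffs n ℝ) : Subfield ℂ :=
  Subfield.closure (Set.range (toComplex q))

/-- The closure of `S ⊆ ℂⁿ` in the Zariski topology whose closed sets are defined by
polynomials with coefficients in `K`. -/
def zariskiClosure {n : ℕ} (K : Type*) [Field K] [Algebra K ℂ] (S : Set (Fin n → ℂ)) :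
    Set (Fin n → ℂ) :=
  {z | ∀ p : MvPolynomial (Fin n) K,
    (∀ s ∈ S, MvPolynomial.aeval s p = 0) → MvPolynomial.aeval z p = 0}

/-- A subset of `ℝⁿ` viewed in `ℂⁿ`. -/
def complexify {n : ℕ} (S : Set (EuclideanSpace ℝ (Fin n))) : Set (Fin n → ℂ) :=
  (fun u i => ((u i : ℝ) : ℂ)) '' S

/-- The algebraic boundary of the SDP-exact region: the Zariski closure, over the field generated
by the coefficients of `f`, of its topological boundary, viewed in complex affine space. -/
def algBoundary {n : ℕ} (q : Coeffs n ℝ) : Set (Fin n → ℂ) :=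
  zariskiClosure (coeffField q) (complexify (frontier (edRegion q)))

/-- The algebraic boundary of the master spectrahedron, in the same sense, in `ℂ`. -/
def masterAlgBoundary {n : ℕ} (q : Coeffs n ℝ) : Set ℂ :=
  {z | ∀ p : Polynomial (coeffField q),
    (∀ l ∈ frontier (masterSpec q), Polynomial.aeval (l : ℂ) p = 0) → Polynomial.aeval z p = 0}

/-- The complex hypersurface `det (I - l A) = 0` in the multiplier space `ℂ`. -/
def detLocus {n : ℕ} (q : Coeffs n ℝ) : Set ℂ :=
  {l | ((1 : Matrix (Fin n) (Fin n) ℂ) - l • matA (toComplex q)).det = 0}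

/-- The map `π : (z, l) ↦ z - (1/2) Jac_f(z) l = z - l (a + A z)`. -/
def piMap {n : ℕ} (q : Coeffs n ℝ) (p : (Fin n → ℂ) × ℂ) : Fin n → ℂ :=
  p.1 - p.2 • halfGrad (toComplex q) p.1

/-- The map `φ`, restricted to `S`, has degree `d`: the fibre over a generic point of the image
`φ(S)` has exactly `d` points. Here generic means: outside the zeros of some polynomial, such
that the points of the image outside these zeros are Zariski dense in the image. -/
def HasDegree {n : ℕ} {X : Type*} (S : Set X) (φ : X → Fin n → ℂ) (d : ℕ) : Prop :=
  ∃ h : MvPolynomial (Fin n) ℂ,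
    φ '' S ⊆ zariskiClosure ℂ {u | u ∈ φ '' S ∧ MvPolynomial.eval u h ≠ 0} ∧
    ∀ u ∈ φ '' S, MvPolynomial.eval u h ≠ 0 → {p | p ∈ S ∧ φ p = u}.ncard = d

/-- The real hyperplane `wᵀ u = c`  (a hyperplane if `w ≠ 0`). -/
def realHyp {n : ℕ} (w : Fin n → ℝ) (c : ℝ) : Set (EuclideanSpace ℝ (Fin n)) :=
  {u | w ⬝ᵥ u.ofLp = c}

/-- The complex hyperplane with the same equation. -/
def complexHyp {n : ℕ} (w : Fin n → ℝ) (c : ℝ) : Set (Fin n → ℂ) :=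
  {z | (fun i => (w i : ℂ)) ⬝ᵥ z = (c : ℂ)}

/-- `V` is an ellipsoid (as a hypersurface). -/
def IsEllipsoid {n : ℕ} (V : Set (EuclideanSpace ℝ (Fin n))) : Prop :=
  ∃ (p : EuclideanSpace ℝ (Fin n)) (Q : Matrix (Fin n) (Fin n) ℝ), Q.PosDef ∧
    V = {x | (x - p).ofLp ⬝ᵥ (Q *ᵥ (x - p).ofLp) = 1}

/-- `B` is a solid ellipsoid in the affine subspace `H`: an ellipsoid of `H` with centre `p ∈ H`,
together with the points of `H` inside it. -/
def IsSolidEllipsoidIn {n : ℕ} (B H : Set (EuclideanSpace ℝ (Fin n))) : Prop :=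
  ∃ p ∈ H, ∃ Q : Matrix (Fin n) (Fin n) ℝ, Q.PosDef ∧
    B = {u | u ∈ H ∧ (u - p).ofLp ⬝ᵥ (Q *ᵥ (u - p).ofLp) ≤ 1}

/-- `B` is a subset of the hyperplane `H = {wᵀ u = c}` that spans `H` and is bounded by a quadric:
for some polynomial `g` whose restriction to `H` has degree two, `B` is the set of the points of
`H` with `g ≤ 0`, and the boundary of `B` relative to `H` is the quadric `g = 0` in `H`. -/
def IsBoundedByQuadricIn {n : ℕ} (B : Set (EuclideanSpace ℝ (Fin n))) (w : Fin n → ℝ) (c : ℝ) :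
    Prop :=
  (affineSpan ℝ B : Set (EuclideanSpace ℝ (Fin n))) = realHyp w c ∧
  ∃ g : Coeffs n ℝ,
    (∃ v : Fin n → ℝ, w ⬝ᵥ v = 0 ∧ v ⬝ᵥ (matA g *ᵥ v) ≠ 0) ∧
    B = {u | u ∈ realHyp w c ∧ quad g u.ofLp ≤ 0} ∧
    intrinsicFrontier ℝ B = {u | u ∈ realHyp w c ∧ quad g u.ofLp = 0}

/-- `x` is a point of `V` nearest to `u`. -/
def IsNearest {n : ℕ} (V : Set (EuclideanSpace ℝ (Fin n))) (u x : EuclideanSpace ℝ (Fin n)) :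
    Prop :=
  x ∈ V ∧ ∀ y ∈ V, dist u x ≤ dist u y

/-- The set of the points that have (at least) two nearest points on `V`. -/
def cutLocus {n : ℕ} (V : Set (EuclideanSpace ℝ (Fin n))) : Set (EuclideanSpace ℝ (Fin n)) :=
  {u | ∃ x y, x ≠ y ∧ IsNearest V u x ∧ IsNearest V u y}

end EDQuadric

end

/-!
Let `f` be a quadratic polynomial whose matrix `A` is invertible with pairwise different
eigenvalues `eigⱼ`, and whose zero set is nonsingular. Orthonormal eigenvectors and the centre of
the quadric give coordinates `Xⱼ` (`PrincipalAxes`) in which the quadric is `∑ eigⱼ Xⱼ² = level`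
and the map `x ↦ x - l (a + A x)` multiplies the `j`-th coordinate by `1 - l eigⱼ`.

*Density.* If `x` is a nonsingular point of `V` nearest to `u`, then `u = x - l (a + A x)` for a
Lagrange multiplier `l`, and `‖y - u‖² - ‖x - u‖² = (y - x)ᵀ (I - l A) (y - x)` for all `y ∈ V`
(`lagrangian_expansion`). A line through `x` that is not tangent to `V` meets `V` in a second point,
unless its direction is isotropic for `A`, where the form `I - l A` is positive anyway. So this form
is nonnegative in all directions that are not tangent, hence positive semidefinite
(`IsNearest.posSemidef_hessian`). On the segment from `x` to `u` the multiplier shrinks to `t l`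
with `t < 1`, and `I - t l A` is positive definite. So `u` is a limit of points of the SDP-exact
region. A singular nearest point `x` is the vertex of a cone, and if `V` has nonsingular points as
well, this forces `u = x`.

*Boundary and cut locus.* For generic `f` the same argument shows that for a point outside the
region the multiplier is an end point `1 / eigᵢ` of the interval of the `l` with `I - l A ≻ 0`.
Hence the complement is the union, over the at most two such `i`, of the images `piece i` of `V`
under `x ↦ x - (a + A x) / eigᵢ` (`Regular.compl_edRegion`). This map kills the `i`-th coordinate,
and all that is lost is the sign of `Xᵢ`, because the other coordinates determine `Xᵢ²`, the
`slack`. So `piece i` is given by `slack ≥ 0` in the hyperplane of the points whose `i`-th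
coordinate vanishes; it is closed, and its relative interior `slack > 0` consists of the points
with two nearest points. As `slack` is a constant plus a quadratic form, the relative interiors
and closures can be read off along rays from the centre. The quadric is an ellipsoid exactly if
all `eigⱼ / level` are positive; then only the largest one gives an end point, and otherwise the
largest and the smallest one do.

*Degree.* Over `ℂ` the image for `l = 1 / eigᵢ` is the whole hyperplane, and off the other
hyperplanes and the zero set of the slack there are exactly two preimages, with opposite `Xᵢ`
(`Regular.hasDegree_two`).

*Algebraic boundaries.* The union of the hyperplanes is the zero set of the Krylov determinant
`det (y, A y, …, A ^ (n - 1) y)` for `y = a + A u`, a polynomial in `u` whose coefficients are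
polynomials in those of `f`. Conversely, the characteristic polynomial of the generic symmetric
matrix is irreducible, because it specializes to that of an arrow matrix, which is linear in the
corner entry with coprime coefficients. So for algebraically independent coefficients all `eigⱼ`
are conjugate over the field of coefficients, and a polynomial over this field that vanishes on
one of the hyperplanes vanishes on all of them.
-/

namespace EDQuadric

/-! ### Quadrics and their principal axes -/

section Coefficients

variable {n : ℕ} {R : Type*}

lemma matA_transpose (q : Coeffs n R) : (matA q)ᵀ = matA q := by
  ext i j
  simp [matA, Sym2.eq_swap]

/-- Coefficients with prescribed symmetric matrix, linear part and constant. -/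
def ofParts (M : Matrix (Fin n) (Fin n) R) (hM : M.IsSymm) (b : Fin n → R) (γ : R) :
    Coeffs n R :=
  Sym2.lift ⟨fun i j => Fin.cases (Fin.cases γ b j)
    (fun i' => Fin.cases (b i') (fun j' => M i' j') j) i, by
      intro i j
      induction i using Fin.cases <;> induction j using Fin.cases <;> simp [hM.apply]⟩

lemma matA_ofParts (M : Matrix (Fin n) (Fin n) R) (hM : M.IsSymm) (b : Fin n → R) (γ : R) :
    matA (ofParts M hM b γ) = M := by
  ext i j; simp [matA, ofParts]

lemma vecA_ofParts (M : Matrix (Fin n) (Fin n) R) (hM : M.IsSymm) (b : Fin n → R) (γ : R) :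
    vecA (ofParts M hM b γ) = b := by
  ext i; simp [vecA, ofParts]

lemma ofParts_zero (M : Matrix (Fin n) (Fin n) R) (hM : M.IsSymm) (b : Fin n → R) (γ : R) :
    ofParts M hM b γ s(0, 0) = γ := by
  simp [ofParts]

end Coefficients

section Algebra

variable {n : ℕ} {R S : Type*} [CommRing R] [CommRing S]

lemma matA_comp (φ : R →+* S) (q : Coeffs n R) : matA (φ ∘ q) = (matA q).map φ := rfl

lemma halfGrad_comp (φ : R →+* S) (q : Coeffs n R) (x : Fin n → R) :
    halfGrad (φ ∘ q) (φ ∘ x) = φ ∘ halfGrad q x := by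
  ext i
  simp [halfGrad, vecA, matA_comp, Matrix.mulVec, dotProduct]

lemma dotProduct_matA_comm (q : Coeffs n R) (x y : Fin n → R) :
    x ⬝ᵥ (matA q *ᵥ y) = y ⬝ᵥ (matA q *ᵥ x) := by
  rw [Matrix.dotProduct_mulVec, ← Matrix.mulVec_transpose, matA_transpose, dotProduct_comm]

lemma halfGrad_add (q : Coeffs n R) (x v : Fin n → R) :
    halfGrad q (x + v) = halfGrad q x + matA q *ᵥ v := by
  simp [halfGrad, Matrix.mulVec_add, add_assoc]

lemma quad_add (q : Coeffs n R) (x v : Fin n → R) :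
    quad q (x + v) = quad q x + 2 * (halfGrad q x ⬝ᵥ v) + v ⬝ᵥ (matA q *ᵥ v) := by
  simp only [quad, halfGrad, Matrix.mulVec_add, add_dotProduct, dotProduct_add]
  rw [dotProduct_comm (matA q *ᵥ x) v, dotProduct_matA_comm q x v]
  ring

/-- If `u = x - l (a + A x)`, then the Lagrangian `‖y - u‖² - l f(y)` is stationary at `x`, so that
it differs from its value at `x` by its Hessian form `(y - x)ᵀ (I - l A) (y - x)`. -/
lemma lagrangian_expansion (q : Coeffs n R) (x y : Fin n → R) (l : R) :
    (y - (x - l • halfGrad q x)) ⬝ᵥ (y - (x - l • halfGrad q x)) =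
      (x - (x - l • halfGrad q x)) ⬝ᵥ (x - (x - l • halfGrad q x)) +
        (y - x) ⬝ᵥ (((1 : Matrix (Fin n) (Fin n) R) - l • matA q) *ᵥ (y - x)) +
        l * (quad q y - quad q x) := by
  obtain ⟨v, rfl⟩ : ∃ v, y = x + v := ⟨y - x, by simp⟩
  rw [quad_add]
  generalize halfGrad q x = g
  have h1 : x + v - (x - l • g) = v + l • g := by abel
  have h2 : x - (x - l • g) = l • g := by abel
  have h3 : x + v - x = v := by abel
  rw [h1, h2, h3]
  simp only [Matrix.sub_mulVec, Matrix.one_mulVec, Matrix.smul_mulVec, dotProduct_add,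
    add_dotProduct, dotProduct_sub, smul_dotProduct, dotProduct_smul, smul_eq_mul]
  rw [dotProduct_comm g v]
  ring

/-- The matrix with columns `y, A y, …, A ^ (n - 1) y`. -/
def krylov (A : Matrix (Fin n) (Fin n) R) (y : Fin n → R) : Matrix (Fin n) (Fin n) R :=
  Matrix.of fun i k => (A ^ (k : ℕ) *ᵥ y) i

lemma krylov_map (φ : R →+* S) (A : Matrix (Fin n) (Fin n) R) (y : Fin n → R) :
    krylov (A.map φ) (φ ∘ y) = (krylov A y).map φ := by
  ext i k
  have h : A.map φ ^ (k : ℕ) = (A ^ (k : ℕ)).map φ := by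
    simpa using (map_pow φ.mapMatrix A (k : ℕ)).symm
  simp [krylov, h, Matrix.mulVec, dotProduct]

/-- An orthogonal change of coordinates about a centre of the quadric which diagonalizes its
matrix: the rows of `axes` are orthonormal eigenvectors of `A` for the eigenvalues `eig`. -/
structure PrincipalAxes (q : Coeffs n R) where
  /-- The orthogonal matrix whose rows are the axes. -/
  axes : Matrix (Fin n) (Fin n) R
  /-- The eigenvalues. -/
  eig : Fin n → R
  /-- The centre. -/
  center : Fin n → R
  axes_mul_transpose : axes * axesᵀ = 1
  axes_mul_matA : axes * matA q = Matrix.diagonal eig * axes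
  halfGrad_center : halfGrad q center = 0

namespace PrincipalAxes

variable {q : Coeffs n R} (P : PrincipalAxes q)

lemma transpose_mul_axes : P.axesᵀ * P.axes = 1 :=
  mul_eq_one_comm.mp P.axes_mul_transpose

/-- The coordinates of a point with respect to the principal axes. -/
def coord (x : Fin n → R) : Fin n → R := P.axes *ᵥ (x - P.center)

/-- The point with given coordinates. -/
def point (X : Fin n → R) : Fin n → R := P.center + P.axesᵀ *ᵥ X

/-- The quadric is `∑ eigⱼ Xⱼ² = level` in the coordinates `X`. -/
def level : R := -quad q P.center

lemma coord_point (X : Fin n → R) : P.coord (P.point X) = X := by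
  simp [coord, point, P.axes_mul_transpose]

lemma point_coord (x : Fin n → R) : P.point (P.coord x) = x := by
  simp [coord, point, P.transpose_mul_axes]

lemma coord_injective : Function.Injective P.coord :=
  Function.LeftInverse.injective P.point_coord

lemma axes_dotProduct_axes (i j : Fin n) :
    P.axes i ⬝ᵥ P.axes j = if i = j then 1 else 0 := by
  have h := congrFun (congrFun P.axes_mul_transpose i) j
  rwa [Matrix.one_apply] at h

lemma coord_apply (x : Fin n → R) (i : Fin n) :
    P.coord x i = P.axes i ⬝ᵥ x - P.axes i ⬝ᵥ P.center := by
  simp [coord, Matrix.mulVec, dotProduct_sub]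

lemma axes_mulVec_dotProduct (x y : Fin n → R) :
    (P.axes *ᵥ x) ⬝ᵥ (P.axes *ᵥ y) = x ⬝ᵥ y := by
  rw [Matrix.dotProduct_mulVec, ← Matrix.mulVec_transpose, Matrix.mulVec_mulVec,
    P.transpose_mul_axes, Matrix.one_mulVec]

lemma coord_sub (x y : Fin n → R) : P.coord x - P.coord y = P.axes *ᵥ (x - y) := by
  rw [coord, coord, ← Matrix.mulVec_sub]
  congr 1
  abel

lemma axes_mulVec_matA (v : Fin n → R) :
    P.axes *ᵥ (matA q *ᵥ v) = fun j => P.eig j * (P.axes *ᵥ v) j := by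
  rw [Matrix.mulVec_mulVec, P.axes_mul_matA, ← Matrix.mulVec_mulVec]
  ext j
  rw [Matrix.mulVec_diagonal]

lemma axes_mulVec_halfGrad (x : Fin n → R) :
    P.axes *ᵥ halfGrad q x = fun j => P.eig j * P.coord x j := by
  have h := halfGrad_add q P.center (x - P.center)
  rw [add_sub_cancel, P.halfGrad_center, zero_add] at h
  rw [h, axes_mulVec_matA]
  rfl

lemma quad_eq (x : Fin n → R) :
    quad q x = ∑ j, P.eig j * P.coord x j ^ 2 - P.level := by
  have h := quad_add q P.center (x - P.center)
  rw [add_sub_cancel, P.halfGrad_center, zero_dotProduct, ← P.axes_mulVec_dotProduct,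
    axes_mulVec_matA] at h
  rw [h, level, mul_zero, add_zero, sub_neg_eq_add, add_comm]
  congr 1
  refine Finset.sum_congr rfl fun j _ => ?_
  rw [coord]
  ring

lemma coord_sub_smul_halfGrad (x : Fin n → R) (l : R) (j : Fin n) :
    P.coord (x - l • halfGrad q x) j = (1 - l * P.eig j) * P.coord x j := by
  have h : P.coord (x - l • halfGrad q x) = P.coord x - l • P.axes *ᵥ halfGrad q x := by
    rw [coord, coord, sub_right_comm, Matrix.mulVec_sub, Matrix.mulVec_smul]
  rw [h, axes_mulVec_halfGrad]
  simp only [Pi.sub_apply, Pi.smul_apply, smul_eq_mul]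
  ring

lemma hessian_eq (l : R) :
    (1 : Matrix (Fin n) (Fin n) R) - l • matA q =
      P.axesᵀ * Matrix.diagonal (fun j => 1 - l * P.eig j) * P.axes := by
  have h : Matrix.diagonal (fun j => 1 - l * P.eig j) =
      (1 : Matrix (Fin n) (Fin n) R) - l • Matrix.diagonal P.eig := by
    ext i j
    by_cases hij : i = j <;> simp [hij, Matrix.diagonal]
  rw [h, Matrix.mul_assoc, Matrix.sub_mul, Matrix.one_mul, Matrix.smul_mul, ← P.axes_mul_matA,
    Matrix.mul_sub, Matrix.mul_smul, ← Matrix.mul_assoc, P.transpose_mul_axes, Matrix.one_mul]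

lemma hessian_form_eq (l : R) (x y : Fin n → R) :
    (y - x) ⬝ᵥ (((1 : Matrix (Fin n) (Fin n) R) - l • matA q) *ᵥ (y - x)) =
      ∑ j, (1 - l * P.eig j) * (P.coord y j - P.coord x j) ^ 2 := by
  have h := P.coord_sub y x
  rw [P.hessian_eq, ← Matrix.mulVec_mulVec, ← Matrix.mulVec_mulVec, ← h, Matrix.dotProduct_mulVec,
    ← Matrix.mulVec_transpose, Matrix.transpose_transpose, ← h, dotProduct]
  refine Finset.sum_congr rfl fun j _ => ?_
  rw [Matrix.mulVec_diagonal]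
  simp only [Pi.sub_apply]
  ring

lemma det_axes_sq : P.axes.det * P.axes.det = 1 := by
  have h := congrArg Matrix.det P.axes_mul_transpose
  rwa [Matrix.det_mul, Matrix.det_transpose, Matrix.det_one] at h

lemma det_hessian (l : R) :
    ((1 : Matrix (Fin n) (Fin n) R) - l • matA q).det = ∏ j, (1 - l * P.eig j) := by
  rw [P.hessian_eq, Matrix.det_mul, Matrix.det_mul, Matrix.det_transpose, mul_right_comm,
    P.det_axes_sq, one_mul, Matrix.det_diagonal]

lemma det_matA : (matA q).det = ∏ j, P.eig j := by
  have h := congrArg Matrix.det P.axes_mul_matA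
  rw [Matrix.det_mul, Matrix.det_mul, Matrix.det_diagonal, mul_comm] at h
  calc (matA q).det = (matA q).det * P.axes.det * P.axes.det := by
        rw [mul_assoc, P.det_axes_sq, mul_one]
    _ = _ := by rw [h, mul_assoc, P.det_axes_sq, mul_one]

/-- The Krylov determinant of `A` is, up to sign, the Vandermonde determinant of the eigenvalues
times the coordinates of the starting vector along the eigenvectors. -/
lemma axes_mul_krylov (y : Fin n → R) :
    P.axes * krylov (matA q) y =
      Matrix.diagonal (P.axes *ᵥ y) * Matrix.vandermonde P.eig := by
  have hpow : ∀ (k : ℕ) (i : Fin n),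
      (P.axes *ᵥ (matA q ^ k *ᵥ y)) i = P.eig i ^ k * (P.axes *ᵥ y) i := by
    intro k
    induction k with
    | zero => simp
    | succ k ih =>
      intro i
      rw [pow_succ', ← Matrix.mulVec_mulVec, axes_mulVec_matA]
      simp only [ih]
      ring
  ext i k
  rw [Matrix.diagonal_mul, Matrix.vandermonde_apply, mul_comm, ← hpow]
  rfl

/-- Principal axes are preserved under ring homomorphisms. -/
def map (φ : R →+* S) : PrincipalAxes (φ ∘ q) where
  axes := P.axes.map φ
  eig := φ ∘ P.eig
  center := φ ∘ P.center
  axes_mul_transpose := by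
    rw [← Matrix.transpose_map, ← Matrix.map_mul, P.axes_mul_transpose]
    simp
  axes_mul_matA := by
    have h : Matrix.diagonal (φ ∘ P.eig) = (Matrix.diagonal P.eig).map φ := by
      rw [Matrix.diagonal_map (map_zero φ)]; rfl
    rw [matA_comp, ← Matrix.map_mul, P.axes_mul_matA, h, Matrix.map_mul]
  halfGrad_center := by
    rw [halfGrad_comp, P.halfGrad_center]
    ext
    simp

lemma level_map (φ : R →+* S) : (P.map φ).level = φ P.level := by
  simp only [level, map, map_neg, quad, matA_comp, vecA, map_add, map_mul, map_ofNat,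
    Matrix.mulVec, dotProduct, map_sum, Function.comp_apply, Matrix.map_apply]

end PrincipalAxes

end Algebra

section Domain

variable {n : ℕ} {R : Type*} [CommRing R] [IsDomain R] {q : Coeffs n R}

lemma PrincipalAxes.det_krylov_ne_zero_iff (P : PrincipalAxes q) (y : Fin n → R) :
    (krylov (matA q) y).det ≠ 0 ↔ (∀ i, (P.axes *ᵥ y) i ≠ 0) ∧ Function.Injective P.eig := by
  have h := congrArg Matrix.det (P.axes_mul_krylov y)
  rw [Matrix.det_mul, Matrix.det_mul, Matrix.det_diagonal] at h
  have h0 : P.axes.det ≠ 0 := left_ne_zero_of_mul (P.det_axes_sq ▸ one_ne_zero)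
  rw [← Matrix.det_vandermonde_ne_zero_iff, ← mul_ne_zero_iff_left h0, h, mul_ne_zero_iff,
    Finset.prod_ne_zero_iff]
  simp

end Domain

/-! ### Nearest points and density of the SDP-exact region -/

section Nearest

open Topology

variable {n : ℕ} {q : Coeffs n ℝ}

lemma dist_le_dist_iff_dotProduct (u x y : EuclideanSpace ℝ (Fin n)) :
    dist u x ≤ dist u y ↔ (x.ofLp - u.ofLp) ⬝ᵥ (x.ofLp - u.ofLp) ≤
      (y.ofLp - u.ofLp) ⬝ᵥ (y.ofLp - u.ofLp) := by
  have h : ∀ z : EuclideanSpace ℝ (Fin n),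
      dist u z = √((z.ofLp - u.ofLp) ⬝ᵥ (z.ofLp - u.ofLp)) := by
    intro z
    rw [dist_comm, EuclideanSpace.dist_eq]
    simp [dotProduct, Real.dist_eq, sq]
  rw [h, h, Real.sqrt_le_sqrt_iff]
  exact dotProduct_self_star_nonneg (y.ofLp - u.ofLp)

lemma posSemidef_hessian_iff (q : Coeffs n ℝ) (l : ℝ) :
    ((1 : Matrix (Fin n) (Fin n) ℝ) - l • matA q).PosSemidef ↔
      ∀ v : Fin n → ℝ, 0 ≤ v ⬝ᵥ (((1 : Matrix (Fin n) (Fin n) ℝ) - l • matA q) *ᵥ v) := by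
  rw [Matrix.posSemidef_iff_dotProduct_mulVec]
  refine ⟨fun h v => by simpa using h.2 v, fun h => ⟨?_, fun v => by simpa using h v⟩⟩
  rw [Matrix.IsHermitian, Matrix.conjTranspose_eq_transpose_of_trivial]
  simp [matA_transpose]

lemma posDef_hessian_iff (q : Coeffs n ℝ) (l : ℝ) :
    ((1 : Matrix (Fin n) (Fin n) ℝ) - l • matA q).PosDef ↔
      ∀ v : Fin n → ℝ, v ≠ 0 →
        0 < v ⬝ᵥ (((1 : Matrix (Fin n) (Fin n) ℝ) - l • matA q) *ᵥ v) := by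
  rw [Matrix.posDef_iff_dotProduct_mulVec]
  refine ⟨fun h v hv => by simpa using h.2 hv, fun h => ⟨?_, fun v hv => by simpa using h v hv⟩⟩
  rw [Matrix.IsHermitian, Matrix.conjTranspose_eq_transpose_of_trivial]
  simp [matA_transpose]

lemma hessian_form (q : Coeffs n ℝ) (l : ℝ) (v : Fin n → ℝ) :
    v ⬝ᵥ (((1 : Matrix (Fin n) (Fin n) ℝ) - l • matA q) *ᵥ v) =
      v ⬝ᵥ v - l * (v ⬝ᵥ (matA q *ᵥ v)) := by
  simp [Matrix.sub_mulVec, Matrix.smul_mulVec]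

lemma mem_edRegion_iff (u : EuclideanSpace ℝ (Fin n)) :
    u ∈ edRegion q ↔ ∃ x ∈ realV q, ∃ l : ℝ,
      ((1 : Matrix (Fin n) (Fin n) ℝ) - l • matA q).PosDef ∧
        u.ofLp = x.ofLp - l • halfGrad q x.ofLp := by
  have key : ∀ (x : Fin n → ℝ) (l : ℝ),
      -u.ofLp - l • vecA q + ((1 : Matrix (Fin n) (Fin n) ℝ) - l • matA q) *ᵥ x = 0 ↔
        u.ofLp = x - l • halfGrad q x := by
    intro x l
    rw [eq_comm (a := u.ofLp), ← sub_eq_zero (b := u.ofLp), halfGrad]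
    have : -u.ofLp - l • vecA q + ((1 : Matrix (Fin n) (Fin n) ℝ) - l • matA q) *ᵥ x =
        x - l • (vecA q + matA q *ᵥ x) - u.ofLp := by
      rw [Matrix.sub_mulVec, Matrix.one_mulVec, Matrix.smul_mulVec, smul_add]
      abel
    rw [this]
  simp only [edRegion, IsSDPExact, Set.mem_ofPred_eq, key]

/-- A point with a multiplier whose Hessian is positive semidefinite is a nearest point. -/
lemma isNearest_of_posSemidef {u x : EuclideanSpace ℝ (Fin n)} {l : ℝ} (hx : x ∈ realV q)
    (hl : ((1 : Matrix (Fin n) (Fin n) ℝ) - l • matA q).PosSemidef)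
    (hu : u.ofLp = x.ofLp - l • halfGrad q x.ofLp) : IsNearest (realV q) u x := by
  refine ⟨hx, fun y hy => ?_⟩
  rw [dist_le_dist_iff_dotProduct, hu, lagrangian_expansion q x.ofLp y.ofLp l,
    show quad q y.ofLp = 0 from hy, show quad q x.ofLp = 0 from hx]
  have := (posSemidef_hessian_iff q l).mp hl (y.ofLp - x.ofLp)
  linarith

/-- The Hessian form vanishes on the difference of two nearest points. -/
lemma hessian_form_sub_eq_zero {u x y : EuclideanSpace ℝ (Fin n)} {l : ℝ}
    (hx : IsNearest (realV q) u x) (hy : IsNearest (realV q) u y)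
    (hu : u.ofLp = x.ofLp - l • halfGrad q x.ofLp) :
    (y.ofLp - x.ofLp) ⬝ᵥ
      (((1 : Matrix (Fin n) (Fin n) ℝ) - l • matA q) *ᵥ (y.ofLp - x.ofLp)) = 0 := by
  have h1 := (dist_le_dist_iff_dotProduct u x y).mp (hx.2 y hy.1)
  have h2 := (dist_le_dist_iff_dotProduct u y x).mp (hy.2 x hx.1)
  have h := lagrangian_expansion q x.ofLp y.ofLp l
  rw [show quad q y.ofLp = 0 from hy.1, show quad q x.ofLp = 0 from hx.1, ← hu] at h
  linarith

lemma fderiv_apply_of_quadratic {E : Type*} [NormedAddCommGroup E] [NormedSpace ℝ E] {F : E → ℝ}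
    {F' : E →L[ℝ] ℝ} {x v : E} (hF : HasFDerivAt F F' x) {b r : ℝ}
    (h : ∀ t : ℝ, F (x + t • v) = F x + t * b + t ^ 2 * r) : F' v = b := by
  have h1 : HasDerivAt (fun t : ℝ => F (x + t • v)) (F' v) 0 := hF.hasLineDerivAt v
  have h2 : HasDerivAt (fun t : ℝ => F x + t * b + t ^ 2 * r) b 0 := by
    have := (((hasDerivAt_id (0 : ℝ)).mul_const b).const_add (F x)).fun_add
      (((hasDerivAt_id (0 : ℝ)).fun_pow 2).mul_const r)
    simpa using this
  simp only [h] at h1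
  exact h1.unique h2

lemma contDiff_quad (q : Coeffs n ℝ) :
    ContDiff ℝ 1 (fun x : EuclideanSpace ℝ (Fin n) => quad q x.ofLp) := by
  unfold quad dotProduct Matrix.mulVec dotProduct
  fun_prop

lemma isClosed_realV (q : Coeffs n ℝ) : IsClosed (realV q) :=
  isClosed_eq (contDiff_quad q).continuous continuous_const

/-- Lagrange multipliers for the nearest point problem at a nonsingular point. -/
lemma IsNearest.exists_multiplier {u x : EuclideanSpace ℝ (Fin n)}
    (hx : IsNearest (realV q) u x) (hg : halfGrad q x.ofLp ≠ 0) :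
    ∃ l : ℝ, u.ofLp = x.ofLp - l • halfGrad q x.ofLp := by
  set φ : EuclideanSpace ℝ (Fin n) → ℝ := fun y => (y.ofLp - u.ofLp) ⬝ᵥ (y.ofLp - u.ofLp) with hφ
  have hφd : ContDiff ℝ 1 φ := by
    unfold φ dotProduct
    fun_prop
  have hf' := (contDiff_quad q).contDiffAt.hasStrictFDerivAt (x := x) one_ne_zero
  have hφ' := hφd.contDiffAt.hasStrictFDerivAt (x := x) one_ne_zero
  have hext : IsLocalExtrOn φ {y | quad q y.ofLp = quad q x.ofLp} x := by
    refine Or.inl (Filter.eventually_of_mem self_mem_nhdsWithin fun y hy => ?_)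
    have hx0 : quad q x.ofLp = 0 := hx.1
    exact (dist_le_dist_iff_dotProduct u x y).mp (hx.2 y (Eq.trans hy hx0))
  obtain ⟨a, b, hab, h⟩ := hext.exists_multipliers_of_hasStrictFDerivAt_1d hf' hφ'
  have hvan : ∀ v : Fin n → ℝ,
      (a • halfGrad q x.ofLp + b • (x.ofLp - u.ofLp)) ⬝ᵥ v = 0 := by
    intro v
    have h1 := fderiv_apply_of_quadratic (v := WithLp.toLp 2 v) hf'.hasFDerivAt
      (b := 2 * (halfGrad q x.ofLp ⬝ᵥ v)) (r := v ⬝ᵥ (matA q *ᵥ v)) (fun t => by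
        simp only [WithLp.ofLp_add, WithLp.ofLp_smul, quad_add, Matrix.mulVec_smul, dotProduct_smul,
          smul_dotProduct, smul_eq_mul]
        ring)
    have h2 := fderiv_apply_of_quadratic (v := WithLp.toLp 2 v) hφ'.hasFDerivAt
      (b := 2 * ((x.ofLp - u.ofLp) ⬝ᵥ v)) (r := v ⬝ᵥ v) (fun t => by
        simp only [hφ, WithLp.ofLp_add, WithLp.ofLp_smul, add_sub_right_comm, dotProduct_smul,
          smul_dotProduct, smul_eq_mul, add_dotProduct, dotProduct_add]
        rw [dotProduct_comm v]
        ring)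
    have h3 := congrArg (fun F : EuclideanSpace ℝ (Fin n) →L[ℝ] ℝ => F (WithLp.toLp 2 v)) h
    simp only [add_apply, smul_apply, h1, h2, zero_apply, smul_eq_mul] at h3
    simp only [add_dotProduct, smul_dotProduct, smul_eq_mul]
    linarith
  have h0 : a • halfGrad q x.ofLp + b • (x.ofLp - u.ofLp) = 0 :=
    dotProduct_self_eq_zero.mp (hvan _)
  have hb : b ≠ 0 := by
    rintro rfl
    rw [zero_smul, add_zero, smul_eq_zero] at h0
    rcases h0 with h0 | h0
    · exact hab (by rw [h0]; rfl)
    · exact hg h0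
  refine ⟨-(a / b), ?_⟩
  have : u.ofLp = x.ofLp + b⁻¹ • (a • halfGrad q x.ofLp) := by
    rw [eq_neg_of_add_eq_zero_left h0, smul_neg, smul_smul, inv_mul_cancel₀ hb, one_smul]
    abel
  rw [this, smul_smul, neg_smul, sub_neg_eq_add]
  congr 2
  ring

/-- In the direction of a secant line through a nonsingular nearest point, minimality of the distance
says exactly that the Hessian form of the Lagrangian is nonnegative. A direction that is not tangent
belongs to a secant line or is isotropic for `A`, and in the latter case the form is positive. By
continuity the form is nonnegative in all directions: the multiplier is dual feasible. -/
lemma IsNearest.posSemidef_hessian {u x : EuclideanSpace ℝ (Fin n)}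
    (hx : IsNearest (realV q) u x) (hg : halfGrad q x.ofLp ≠ 0) {l : ℝ}
    (hu : u.ofLp = x.ofLp - l • halfGrad q x.ofLp) :
    ((1 : Matrix (Fin n) (Fin n) ℝ) - l • matA q).PosSemidef := by
  rw [posSemidef_hessian_iff]
  have hx0 : quad q x.ofLp = 0 := hx.1
  set g := halfGrad q x.ofLp with hgdef
  -- directions of secant lines, and isotropic directions
  have hsec : ∀ v : Fin n → ℝ, g ⬝ᵥ v ≠ 0 →
      0 ≤ v ⬝ᵥ (((1 : Matrix (Fin n) (Fin n) ℝ) - l • matA q) *ᵥ v) := by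
    intro v hv
    by_cases hA : v ⬝ᵥ (matA q *ᵥ v) = 0
    · rw [hessian_form, hA, mul_zero, sub_zero]
      exact dotProduct_self_star_nonneg v
    · set t : ℝ := -2 * (g ⬝ᵥ v) / (v ⬝ᵥ (matA q *ᵥ v)) with ht
      have ht0 : t ≠ 0 := div_ne_zero (mul_ne_zero (by norm_num) hv) hA
      have hy : quad q (x.ofLp + t • v) = 0 := by
        simp only [quad_add, hx0, Matrix.mulVec_smul, dotProduct_smul, smul_dotProduct,
          smul_eq_mul, ← hgdef]
        have : t * (v ⬝ᵥ (matA q *ᵥ v)) = -2 * (g ⬝ᵥ v) := by rw [ht]; field_simp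
        rw [this]
        ring
      have hle := (dist_le_dist_iff_dotProduct u x _).mp
        (hx.2 (WithLp.toLp 2 (x.ofLp + t • v)) hy)
      have hexp := lagrangian_expansion q x.ofLp (x.ofLp + t • v) l
      rw [← hgdef, ← hu] at hexp
      simp only at hle
      rw [hexp, hy, hx0, add_sub_cancel_left, Matrix.mulVec_smul,
        dotProduct_smul, smul_dotProduct, smul_eq_mul, smul_eq_mul] at hle
      have hpos : 0 < t * t := mul_self_pos.mpr ht0
      by_contra! hneg
      nlinarith [mul_neg_of_pos_of_neg hpos hneg]
  intro v
  by_cases hv : g ⬝ᵥ v = 0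
  · have hcont : Continuous fun s : ℝ =>
        (v + s • g) ⬝ᵥ (((1 : Matrix (Fin n) (Fin n) ℝ) - l • matA q) *ᵥ (v + s • g)) := by
      unfold dotProduct Matrix.mulVec dotProduct
      fun_prop
    have hlim := (hcont.tendsto 0).mono_left (nhdsWithin_le_nhds (s := {0}ᶜ))
    rw [zero_smul, add_zero] at hlim
    refine ge_of_tendsto hlim (Filter.eventually_of_mem self_mem_nhdsWithin fun s hs => hsec _ ?_)
    rw [dotProduct_add, hv, zero_add, dotProduct_smul, smul_eq_mul]
    exact mul_ne_zero hs (fun h => hg (dotProduct_self_eq_zero.mp h))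
  · exact hsec v hv

lemma exists_isNearest (h : (realV q).Nonempty) (u : EuclideanSpace ℝ (Fin n)) :
    ∃ x, IsNearest (realV q) u x := by
  obtain ⟨x, hx, hd⟩ := (isClosed_realV q).exists_infDist_eq_dist h u
  exact ⟨x, hx, fun y hy => hd ▸ Metric.infDist_le_dist_of_mem hy⟩

/-- The segment from a nearest point with a dual feasible multiplier lies in the SDP-exact
region, except possibly for its far end. -/
lemma mem_closure_edRegion_of_posSemidef {u x : EuclideanSpace ℝ (Fin n)} {l : ℝ}
    (hx : x ∈ realV q) (hl : ((1 : Matrix (Fin n) (Fin n) ℝ) - l • matA q).PosSemidef)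
    (hu : u.ofLp = x.ofLp - l • halfGrad q x.ofLp) : u ∈ closure (edRegion q) := by
  have hcont : Continuous fun t : ℝ => x + t • (u - x) := by fun_prop
  have hlim := (hcont.tendsto 1).mono_left (nhdsWithin_le_nhds (s := Set.Iio 1))
  rw [one_smul, add_sub_cancel] at hlim
  have hev : ∀ᶠ t : ℝ in 𝓝[<] 1, t ∈ Set.Ioo (0 : ℝ) 1 :=
    Ioo_mem_nhdsLT one_pos
  refine mem_closure_of_tendsto hlim (hev.mono fun t ht => ?_)
  rw [mem_edRegion_iff]
  refine ⟨x, hx, t * l, ?_, ?_⟩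
  · rw [posDef_hessian_iff]
    intro v hv
    have h1 := (posSemidef_hessian_iff q l).mp hl v
    rw [hessian_form] at h1 ⊢
    have h2 : 0 < v ⬝ᵥ v := lt_of_le_of_ne (dotProduct_self_star_nonneg v)
      (fun h => hv (dotProduct_self_eq_zero.mp h.symm))
    nlinarith [mul_nonneg ht.1.le h1, mul_pos (sub_pos.mpr ht.2) h2]
  · simp only [WithLp.ofLp_add, WithLp.ofLp_smul, WithLp.ofLp_sub, hu, mul_smul]
    module

lemma realV_subset_edRegion : realV q ⊆ edRegion q := by
  intro x hx
  rw [mem_edRegion_iff]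
  refine ⟨x, hx, 0, ?_, by simp⟩
  simpa using Matrix.PosDef.one

/-- If the vertex of a quadratic cone with a nonsingular point is nearest to `u`, then `u` is
orthogonal, as seen from the vertex, to all isotropic vectors, which span the space. -/
lemma IsNearest.eq_of_halfGrad_eq_zero {u x : EuclideanSpace ℝ (Fin n)}
    (hx : IsNearest (realV q) u x) (hg : halfGrad q x.ofLp = 0)
    (hV : ∃ y ∈ realV q, halfGrad q y.ofLp ≠ 0) : u = x := by
  have hx0 : quad q x.ofLp = 0 := hx.1
  have hiso : ∀ w : Fin n → ℝ, w ⬝ᵥ (matA q *ᵥ w) = 0 → (x.ofLp - u.ofLp) ⬝ᵥ w = 0 := by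
    intro w hw
    have hle : ∀ t : ℝ, 0 ≤ t * (2 * ((x.ofLp - u.ofLp) ⬝ᵥ w)) + t ^ 2 * (w ⬝ᵥ w) := by
      intro t
      have hy : quad q (x.ofLp + t • w) = 0 := by
        simp [quad_add, hx0, hg, Matrix.mulVec_smul, hw]
      have := (dist_le_dist_iff_dotProduct u x _).mp
        (hx.2 (WithLp.toLp 2 (x.ofLp + t • w)) hy)
      simp only [add_sub_right_comm, dotProduct_smul,
          smul_dotProduct, smul_eq_mul, add_dotProduct, dotProduct_add] at this
      rw [dotProduct_comm w] at this
      linarith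
    have hd := discrim_le_zero (a := w ⬝ᵥ w) (b := 2 * ((x.ofLp - u.ofLp) ⬝ᵥ w)) (c := 0)
      (fun t => by have := hle t; nlinarith)
    rw [discrim] at hd
    nlinarith [sq_nonneg ((x.ofLp - u.ofLp) ⬝ᵥ w)]
  obtain ⟨y, hy, hyg⟩ := hV
  obtain ⟨w, hw⟩ : ∃ w, y.ofLp = x.ofLp + w := ⟨y.ofLp - x.ofLp, by simp⟩
  have hAw : matA q *ᵥ w ≠ 0 := by
    rwa [hw, halfGrad_add, hg, zero_add] at hyg
  have hw0 : w ⬝ᵥ (matA q *ᵥ w) = 0 := by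
    have : quad q y.ofLp = 0 := hy
    rw [hw, quad_add, hx0, hg] at this
    simpa using this
  have hgen : ∀ v : Fin n → ℝ, v ⬝ᵥ (matA q *ᵥ w) ≠ 0 → (x.ofLp - u.ofLp) ⬝ᵥ v = 0 := by
    intro v hv
    -- the line through `v` in direction `w` meets the isotropic cone
    set s : ℝ := -(v ⬝ᵥ (matA q *ᵥ v)) / (2 * (v ⬝ᵥ (matA q *ᵥ w))) with hs
    have h1 := hiso (v + s • w) (by
      simp only [Matrix.mulVec_add, Matrix.mulVec_smul, dotProduct_add, add_dotProduct,
        dotProduct_smul, smul_dotProduct, smul_eq_mul, hw0]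
      rw [dotProduct_matA_comm q w v, hs]
      field_simp
      ring)
    rwa [dotProduct_add, dotProduct_smul, hiso w hw0, smul_zero, add_zero] at h1
  have hall : ∀ v : Fin n → ℝ, (x.ofLp - u.ofLp) ⬝ᵥ v = 0 := by
    intro v
    have hAA : (matA q *ᵥ w) ⬝ᵥ (matA q *ᵥ w) ≠ 0 := fun h => hAw (dotProduct_self_eq_zero.mp h)
    by_cases hv : v ⬝ᵥ (matA q *ᵥ w) = 0
    · have h1 := hgen (v + matA q *ᵥ w) (by rwa [add_dotProduct, hv, zero_add])
      rwa [dotProduct_add, hgen _ hAA, add_zero] at h1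
    · exact hgen v hv
  have := dotProduct_self_eq_zero.mp (hall (x.ofLp - u.ofLp))
  ext i
  have := congrFun this i
  simp only [Pi.sub_apply, Pi.zero_apply] at this
  linarith

/-- The SDP-exact region of a quadric with a nonsingular point is dense. -/
theorem dense_edRegion (hV : ∃ x ∈ realV q, halfGrad q x.ofLp ≠ 0) : Dense (edRegion q) := by
  intro u
  obtain ⟨x, hx⟩ := exists_isNearest ⟨hV.choose, hV.choose_spec.1⟩ u
  by_cases hg : halfGrad q x.ofLp = 0
  · rw [hx.eq_of_halfGrad_eq_zero hg hV]
    exact subset_closure (realV_subset_edRegion hx.1)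
  · obtain ⟨l, hl⟩ := hx.exists_multiplier hg
    exact mem_closure_edRegion_of_posSemidef hx.1 (hx.posSemidef_hessian hg hl) hl

end Nearest

/-! ### The complement of the SDP-exact region and the cut locus -/

namespace PrincipalAxes

section Field

variable {n : ℕ} {F : Type*} [Field F] {q : Coeffs n F} (P : PrincipalAxes q)

/-- The quadric is a nonsingular central quadric with pairwise different axes. -/
structure Regular : Prop where
  eig_injective : Function.Injective P.eig
  eig_ne_zero : ∀ i, P.eig i ≠ 0
  level_ne_zero : P.level ≠ 0

/-- If `u` is the image of a point `x` of the quadric under `x ↦ x - l (a + A x)` with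
`l = 1 / eigᵢ`, then the `i`-th coordinate of `u` vanishes, and the other coordinates of `u`
determine all coordinates of `x` except the `i`-th, and also the square of the `i`-th.
This square, as a function of the coordinates of `u`, is the slack. -/
def slack (i : Fin n) (U : Fin n → F) : F :=
  (P.level - ∑ j ∈ Finset.univ.erase i, P.eig j * (U j / (1 - P.eig j / P.eig i)) ^ 2) / P.eig i

variable {P}

lemma Regular.one_sub_ne_zero (hP : P.Regular) {i j : Fin n} (h : j ≠ i) :
    1 - P.eig j / P.eig i ≠ 0 := by
  rw [sub_ne_zero, ne_comm, Ne, div_eq_one_iff_eq (hP.eig_ne_zero i)]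
  exact fun h' => h (hP.eig_injective h')

lemma slack_smul (i : Fin n) (s : F) (U : Fin n → F) :
    P.slack i (s • U) = P.level / P.eig i + s ^ 2 * (P.slack i U - P.level / P.eig i) := by
  have : ∑ j ∈ Finset.univ.erase i, P.eig j * ((s • U) j / (1 - P.eig j / P.eig i)) ^ 2 =
      s ^ 2 * ∑ j ∈ Finset.univ.erase i, P.eig j * (U j / (1 - P.eig j / P.eig i)) ^ 2 := by
    rw [Finset.mul_sum]
    refine Finset.sum_congr rfl fun j _ => ?_
    simp only [Pi.smul_apply, smul_eq_mul]
    ring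
  rw [slack, slack, this]
  ring

lemma slack_zero (i : Fin n) : P.slack i 0 = P.level / P.eig i := by
  simp [slack]

lemma Regular.halfGrad_ne_zero (hP : P.Regular) {x : Fin n → F} (hx : quad q x = 0) :
    halfGrad q x ≠ 0 := by
  intro h
  have h1 := P.axes_mulVec_halfGrad x
  rw [h, Matrix.mulVec_zero] at h1
  have h2 : ∀ j, P.coord x j = 0 := fun j =>
    (mul_eq_zero.mp (congrFun h1 j).symm).resolve_left (hP.eig_ne_zero j)
  have h3 := P.quad_eq x
  simp [h2, hx] at h3
  exact hP.level_ne_zero h3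

lemma Regular.quad_eq_zero_and_coord_eq_iff (hP : P.Regular) (i : Fin n) (x u : Fin n → F) :
    quad q x = 0 ∧ u = x - (P.eig i)⁻¹ • halfGrad q x ↔
      P.coord u i = 0 ∧ (∀ j, j ≠ i → P.coord x j = P.coord u j / (1 - P.eig j / P.eig i)) ∧
        P.coord x i ^ 2 = P.slack i (P.coord u) := by
  have h1 : u = x - (P.eig i)⁻¹ • halfGrad q x ↔
      P.coord u i = 0 ∧ (∀ j, j ≠ i → P.coord x j = P.coord u j / (1 - P.eig j / P.eig i)) := by
    rw [← P.coord_injective.eq_iff, funext_iff]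
    simp only [coord_sub_smul_halfGrad]
    constructor
    · intro h
      refine ⟨by rw [h, inv_mul_cancel₀ (hP.eig_ne_zero i), sub_self, zero_mul], fun j hj => ?_⟩
      rw [eq_div_iff (hP.one_sub_ne_zero hj), h, div_eq_inv_mul]
      ring
    · rintro ⟨hi, h⟩ j
      by_cases hj : j = i
      · rw [hj, hi, inv_mul_cancel₀ (hP.eig_ne_zero i), sub_self, zero_mul]
      · rw [h j hj, ← div_eq_inv_mul, mul_div_cancel₀ _ (hP.one_sub_ne_zero hj)]
  rw [h1, and_comm, and_assoc]
  refine and_congr_right fun _ => and_congr_right fun h => ?_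
  have hs : ∑ j ∈ Finset.univ.erase i, P.eig j * (P.coord u j / (1 - P.eig j / P.eig i)) ^ 2 =
      ∑ j ∈ Finset.univ.erase i, P.eig j * P.coord x j ^ 2 :=
    Finset.sum_congr rfl fun j hj => by rw [h j (Finset.ne_of_mem_erase hj)]
  rw [slack, hs, eq_div_iff (hP.eig_ne_zero i), P.quad_eq,
    ← Finset.add_sum_erase _ _ (Finset.mem_univ i), sub_eq_zero, eq_sub_iff_add_eq, mul_comm]

variable (P) in
/-- The matrix which is diagonal in the coordinates along the principal axes. -/
def ofDiagonal (d : Fin n → F) : Matrix (Fin n) (Fin n) F :=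
  P.axesᵀ * Matrix.diagonal d * P.axes

lemma ofDiagonal_isSymm (d : Fin n → F) : (P.ofDiagonal d).IsSymm := by
  simp [Matrix.IsSymm, ofDiagonal, Matrix.mul_assoc]

lemma dotProduct_ofDiagonal_mulVec (d : Fin n → F) (v : Fin n → F) :
    v ⬝ᵥ (P.ofDiagonal d *ᵥ v) = ∑ j, d j * (P.axes *ᵥ v) j ^ 2 := by
  rw [ofDiagonal, ← Matrix.mulVec_mulVec, ← Matrix.mulVec_mulVec, Matrix.dotProduct_mulVec,
    ← Matrix.mulVec_transpose, Matrix.transpose_transpose, dotProduct]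
  refine Finset.sum_congr rfl fun j _ => ?_
  rw [Matrix.mulVec_diagonal]
  ring

variable (P) in
/-- A polynomial of degree at most two whose restriction to the hyperplane of the points with
vanishing `i`-th coordinate is the negative of the slack. -/
def slackCoeffs (i : Fin n) : Coeffs n F :=
  let M := P.ofDiagonal fun j =>
    if j = i then 0 else P.eig j / (1 - P.eig j / P.eig i) ^ 2 / P.eig i
  ofParts M (ofDiagonal_isSymm _) (-(M *ᵥ P.center))
    (P.center ⬝ᵥ (M *ᵥ P.center) - P.level / P.eig i)

lemma quad_slackCoeffs (i : Fin n) (u : Fin n → F) :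
    quad (P.slackCoeffs i) u = -P.slack i (P.coord u) := by
  have hc : halfGrad (P.slackCoeffs i) P.center = 0 := by
    simp [halfGrad, slackCoeffs, matA_ofParts, vecA_ofParts]
  have h := quad_add (P.slackCoeffs i) P.center (u - P.center)
  rw [add_sub_cancel, hc, zero_dotProduct, mul_zero, add_zero] at h
  have hq : quad (P.slackCoeffs i) P.center = -(P.level / P.eig i) := by
    simp only [quad, slackCoeffs, matA_ofParts, vecA_ofParts, ofParts_zero, neg_dotProduct]
    rw [dotProduct_comm _ P.center]
    ring
  rw [h, hq, slackCoeffs, matA_ofParts, dotProduct_ofDiagonal_mulVec,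
    ← Finset.add_sum_erase Finset.univ _ (Finset.mem_univ i), slack, sub_div, Finset.sum_div,
    if_pos rfl, zero_mul, zero_add, neg_sub, neg_add_eq_sub]
  congr 1
  refine Finset.sum_congr rfl fun j hj => ?_
  rw [if_neg (Finset.ne_of_mem_erase hj), coord]
  generalize 1 - P.eig j / P.eig i = d
  ring

end Field

section Real

open Topology

variable {n : ℕ} {q : Coeffs n ℝ} {P : PrincipalAxes q}

lemma posSemidef_iff (P : PrincipalAxes q) (l : ℝ) :
    ((1 : Matrix (Fin n) (Fin n) ℝ) - l • matA q).PosSemidef ↔ ∀ j, 0 ≤ 1 - l * P.eig j := by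
  rw [posSemidef_hessian_iff, P.hessian_eq]
  simp only [← ofDiagonal.eq_def, dotProduct_ofDiagonal_mulVec]
  refine ⟨fun h j => ?_, fun h v => Finset.sum_nonneg fun j _ => mul_nonneg (h j) (sq_nonneg _)⟩
  have := h (P.axesᵀ *ᵥ Pi.single j 1)
  rw [Matrix.mulVec_mulVec, P.axes_mul_transpose, Matrix.one_mulVec] at this
  simpa [Pi.single_apply] using this

lemma posDef_ofDiagonal {d : Fin n → ℝ} (hd : ∀ j, 0 < d j) : (P.ofDiagonal d).PosDef := by
  rw [Matrix.posDef_iff_dotProduct_mulVec]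
  refine ⟨by rw [Matrix.IsHermitian, Matrix.conjTranspose_eq_transpose_of_trivial,
    (P.ofDiagonal_isSymm d).eq], fun v hv => ?_⟩
  rw [star_trivial, dotProduct_ofDiagonal_mulVec]
  have hne : P.axes *ᵥ v ≠ 0 := by
    intro h
    apply hv
    rw [← Matrix.one_mulVec v, ← P.transpose_mul_axes, ← Matrix.mulVec_mulVec, h,
      Matrix.mulVec_zero]
  obtain ⟨j, hj⟩ := Function.ne_iff.mp hne
  exact Finset.sum_pos' (fun k _ => mul_nonneg (hd k).le (sq_nonneg _))
    ⟨j, Finset.mem_univ j, mul_pos (hd j) (sq_pos_iff.mpr hj)⟩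

lemma posDef_iff (P : PrincipalAxes q) (l : ℝ) :
    ((1 : Matrix (Fin n) (Fin n) ℝ) - l • matA q).PosDef ↔ ∀ j, 0 < 1 - l * P.eig j := by
  refine ⟨fun h j => ?_, fun h => ?_⟩
  · have h1 := (P.posSemidef_iff l).mp h.posSemidef j
    refine lt_of_le_of_ne h1 fun h0 => h.isUnit.map Matrix.detMonoidHom |>.ne_zero ?_
    rw [Matrix.coe_detMonoidHom, P.det_hessian]
    exact Finset.prod_eq_zero (Finset.mem_univ j) h0.symm
  · rw [P.hessian_eq]
    exact P.posDef_ofDiagonal h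

variable (P) in
/-- The eigenvalue `eigᵢ` is the reciprocal of an end point of the interval of the `l` with
`I - l A ≻ 0`. -/
def IsExtreme (i : Fin n) : Prop := ∀ j, j ≠ i → P.eig j / P.eig i < 1

lemma IsExtreme.posSemidef (hP : P.Regular) {i : Fin n} (hi : P.IsExtreme i) :
    ((1 : Matrix (Fin n) (Fin n) ℝ) - (P.eig i)⁻¹ • matA q).PosSemidef := by
  rw [P.posSemidef_iff]
  intro j
  rw [← div_eq_inv_mul]
  by_cases hj : j = i
  · rw [hj, div_self (hP.eig_ne_zero i), sub_self]
  · exact (sub_pos.mpr (hi j hj)).le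

lemma Regular.isExtreme (hP : P.Regular) {l : ℝ} {i : Fin n} (hl : ∀ j, 0 ≤ 1 - l * P.eig j)
    (hi : 1 - l * P.eig i = 0) : l = (P.eig i)⁻¹ ∧ P.IsExtreme i := by
  have h : l = (P.eig i)⁻¹ := eq_inv_of_mul_eq_one_left (sub_eq_zero.mp hi).symm
  refine ⟨h, fun j hj => ?_⟩
  have h1 := hl j
  rw [h, ← div_eq_inv_mul] at h1
  exact sub_pos.mp (lt_of_le_of_ne h1 (hP.one_sub_ne_zero hj).symm)

variable (P) in
/-- The image, under `x ↦ x - l (a + A x)` with `l = 1 / eigᵢ`, of the real quadric. -/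
def piece (i : Fin n) : Set (EuclideanSpace ℝ (Fin n)) :=
  {u | P.coord u.ofLp i = 0 ∧ 0 ≤ P.slack i (P.coord u.ofLp)}

variable (P) in
/-- The points over which the map from the quadric to `P.piece i` is two-to-one. -/
def core (i : Fin n) : Set (EuclideanSpace ℝ (Fin n)) :=
  {u | P.coord u.ofLp i = 0 ∧ 0 < P.slack i (P.coord u.ofLp)}

lemma core_subset_piece (i : Fin n) : P.core i ⊆ P.piece i := fun _ hu => ⟨hu.1, hu.2.le⟩

/-- A preimage of a point of `P.piece i`, one for each sign of its `i`-th coordinate. -/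
lemma Regular.exists_preimage (hP : P.Regular) {i : Fin n} {u : EuclideanSpace ℝ (Fin n)}
    {r : ℝ} (hu : P.coord u.ofLp i = 0) (hr : r ^ 2 = P.slack i (P.coord u.ofLp)) :
    ∃ x ∈ realV q, u.ofLp = x.ofLp - (P.eig i)⁻¹ • halfGrad q x.ofLp ∧ P.coord x.ofLp i = r := by
  let X : Fin n → ℝ := fun j => if j = i then r else P.coord u.ofLp j / (1 - P.eig j / P.eig i)
  have h := (hP.quad_eq_zero_and_coord_eq_iff i (P.point X) u.ofLp).mpr ⟨hu, fun j hj => by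
    simp [P.coord_point, X, hj], by simp [P.coord_point, X, hr]⟩
  exact ⟨WithLp.toLp 2 (P.point X), h.1, h.2, by simp [P.coord_point, X]⟩

/-- A dual feasible multiplier on the boundary of the feasible interval excludes a multiplier in
the interior: the Hessian at the latter forces a unique nearest point, and then the nonzero
gradient there a unique multiplier. -/
lemma Regular.notMem_edRegion (hP : P.Regular) {x u : EuclideanSpace ℝ (Fin n)} {i : Fin n}
    (hi : P.IsExtreme i) (hx : x ∈ realV q)
    (hu : u.ofLp = x.ofLp - (P.eig i)⁻¹ • halfGrad q x.ofLp) : u ∉ edRegion q := by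
  rw [mem_edRegion_iff]
  rintro ⟨y, hy, l, hl, hyu⟩
  have hxn := isNearest_of_posSemidef hx (hi.posSemidef hP) hu
  have hyn := isNearest_of_posSemidef hy hl.posSemidef hyu
  have h0 := hessian_form_sub_eq_zero hyn hxn hyu
  have hxy : x.ofLp - y.ofLp = 0 := by
    by_contra hne
    exact ((posDef_hessian_iff q l).mp hl _ hne).ne' h0
  rw [sub_eq_zero] at hxy
  rw [hu, hxy, sub_right_inj] at hyu
  have hll := smul_left_injective ℝ (hP.halfGrad_ne_zero (x := y.ofLp) hy) hyu
  have := (P.posDef_iff l).mp hl i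
  rw [← hll, inv_mul_cancel₀ (hP.eig_ne_zero i), sub_self] at this
  exact this.false

/-- Outside the SDP-exact region, the multiplier at a nearest point is an end point of the
feasible interval. -/
theorem Regular.compl_edRegion (hP : P.Regular) (hV : (realV q).Nonempty) :
    (edRegion q)ᶜ = ⋃ i : {i // P.IsExtreme i}, P.piece i := by
  ext u
  simp only [Set.mem_compl_iff, Set.mem_iUnion, Subtype.exists, exists_prop]
  constructor
  · intro hu
    obtain ⟨x, hx⟩ := exists_isNearest hV u
    have hg := hP.halfGrad_ne_zero (x := x.ofLp) hx.1
    obtain ⟨l, hl⟩ := hx.exists_multiplier hg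
    have hpsd := hx.posSemidef_hessian hg hl
    have hnpd : ¬((1 : Matrix (Fin n) (Fin n) ℝ) - l • matA q).PosDef := fun h =>
      hu ((mem_edRegion_iff u).mpr ⟨x, hx.1, l, h, hl⟩)
    rw [P.posSemidef_iff] at hpsd
    rw [P.posDef_iff] at hnpd
    push Not at hnpd
    obtain ⟨i, hi⟩ := hnpd
    obtain ⟨rfl, hext⟩ := hP.isExtreme hpsd (le_antisymm hi (hpsd i))
    have h := (hP.quad_eq_zero_and_coord_eq_iff i x.ofLp u.ofLp).mp ⟨hx.1, hl⟩
    exact ⟨i, hext, h.1, h.2.2 ▸ sq_nonneg _⟩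
  · rintro ⟨i, hi, hu0, hu⟩
    obtain ⟨x, hx, hxu, -⟩ := hP.exists_preimage hu0 (Real.sq_sqrt hu)
    exact hP.notMem_edRegion hi hx hxu

/-- Two nearest points of `u` differ only in one coordinate, in which they are opposite. -/
theorem Regular.cutLocus_eq (hP : P.Regular) :
    cutLocus (realV q) = ⋃ i : {i // P.IsExtreme i}, P.core i := by
  ext u
  simp only [Set.mem_iUnion, Subtype.exists, exists_prop]
  constructor
  · rintro ⟨x, y, hxy, hx, hy⟩
    have hg := hP.halfGrad_ne_zero (x := x.ofLp) hx.1
    obtain ⟨l, hl⟩ := hx.exists_multiplier hg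
    have hpsd := (P.posSemidef_iff l).mp (hx.posSemidef_hessian hg hl)
    have h0 := hessian_form_sub_eq_zero hx hy hl
    rw [P.hessian_form_eq, Finset.sum_eq_zero_iff_of_nonneg fun j _ =>
      mul_nonneg (hpsd j) (sq_nonneg _)] at h0
    have hne : P.coord y.ofLp ≠ P.coord x.ofLp := fun h =>
      hxy (by ext i; rw [P.coord_injective h])
    obtain ⟨i, hi⟩ := Function.ne_iff.mp hne
    have hi0 : 1 - l * P.eig i = 0 := (mul_eq_zero.mp (h0 i (Finset.mem_univ i))).resolve_right
      (pow_ne_zero 2 (sub_ne_zero.mpr hi))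
    obtain ⟨rfl, hext⟩ := hP.isExtreme hpsd hi0
    have hcoord : ∀ j, j ≠ i → P.coord y.ofLp j = P.coord x.ofLp j := by
      intro j hj
      have h1 := (mul_eq_zero.mp (h0 j (Finset.mem_univ j))).resolve_left (by
        rw [← div_eq_inv_mul]; exact hP.one_sub_ne_zero hj)
      exact sub_eq_zero.mp (pow_eq_zero_iff two_ne_zero |>.mp h1)
    have h := (hP.quad_eq_zero_and_coord_eq_iff i x.ofLp u.ofLp).mp ⟨hx.1, hl⟩
    refine ⟨i, hext, h.1, ?_⟩
    rw [← h.2.2]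
    refine sq_pos_iff.mpr fun hx0 => hi ?_
    have h1 := P.quad_eq x.ofLp
    have h2 := P.quad_eq y.ofLp
    rw [show quad q x.ofLp = 0 from hx.1, ← Finset.add_sum_erase _ _ (Finset.mem_univ i)] at h1
    rw [show quad q y.ofLp = 0 from hy.1, ← Finset.add_sum_erase _ _ (Finset.mem_univ i),
      Finset.sum_congr rfl fun j hj => by rw [hcoord j (Finset.ne_of_mem_erase hj)]] at h2
    have h3 : P.eig i * P.coord y.ofLp i ^ 2 = 0 := by
      rw [hx0] at h1
      linarith
    rw [hx0]
    simpa [hP.eig_ne_zero i] using h3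
  · rintro ⟨i, hi, hu0, hu⟩
    obtain ⟨x, hx, hxu, hxi⟩ := hP.exists_preimage hu0 (Real.sq_sqrt hu.le)
    obtain ⟨y, hy, hyu, hyi⟩ := hP.exists_preimage hu0
      (show (-√(P.slack i (P.coord u.ofLp))) ^ 2 = _ by rw [neg_sq, Real.sq_sqrt hu.le])
    refine ⟨x, y, ?_, isNearest_of_posSemidef hx (hi.posSemidef hP) hxu,
      isNearest_of_posSemidef hy (hi.posSemidef hP) hyu⟩
    rintro rfl
    have := Real.sqrt_pos.mpr hu
    linarith

lemma continuous_coord (P : PrincipalAxes q) (i : Fin n) :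
    Continuous fun u : EuclideanSpace ℝ (Fin n) => P.coord u.ofLp i := by
  simp only [coord_apply, dotProduct]
  fun_prop

lemma continuous_slack (P : PrincipalAxes q) (i : Fin n) :
    Continuous fun u : EuclideanSpace ℝ (Fin n) => P.slack i (P.coord u.ofLp) := by
  simp only [slack]
  have := P.continuous_coord
  fun_prop

lemma isClosed_piece (i : Fin n) : IsClosed (P.piece i) :=
  (isClosed_eq (P.continuous_coord i) continuous_const).inter
    (isClosed_le continuous_const (P.continuous_slack i))

lemma Regular.dense_edRegion (hP : P.Regular) (hV : (realV q).Nonempty) :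
    Dense (edRegion q) :=
  EDQuadric.dense_edRegion ⟨hV.choose, hV.choose_spec, hP.halfGrad_ne_zero hV.choose_spec⟩

theorem Regular.frontier_edRegion (hP : P.Regular) (hV : (realV q).Nonempty) :
    frontier (edRegion q) = (edRegion q)ᶜ := by
  have hopen : IsOpen (edRegion q) := by
    rw [← isClosed_compl_iff, hP.compl_edRegion hV]
    exact isClosed_iUnion_of_finite fun i => isClosed_piece i.1
  rw [hopen.frontier_eq, (hP.dense_edRegion hV).closure_eq, Set.compl_eq_univ_sdiff]

end Real

end PrincipalAxes

open Topology in
lemma mem_intrinsicInterior_iff_mem_nhdsWithin {E : Type*} [NormedAddCommGroup E]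
    [NormedSpace ℝ E] {s : Set E} {x : E} :
    x ∈ intrinsicInterior ℝ s ↔ x ∈ affineSpan ℝ s ∧ s ∈ 𝓝[affineSpan ℝ s] x := by
  rw [mem_intrinsicInterior]
  constructor
  · rintro ⟨y, hy, rfl⟩
    exact ⟨y.2, preimage_coe_mem_nhds_subtype.mp (mem_interior_iff_mem_nhds.mp hy)⟩
  · rintro ⟨hx, h⟩
    exact ⟨⟨x, hx⟩, mem_interior_iff_mem_nhds.mpr (preimage_coe_mem_nhds_subtype.mpr h), rfl⟩

namespace PrincipalAxes

open Topology

variable {n : ℕ} {q : Coeffs n ℝ} {P : PrincipalAxes q}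

/-! ### The pieces of the boundary as sets in their hyperplanes -/

lemma mem_realHyp_iff (i : Fin n) (u : EuclideanSpace ℝ (Fin n)) :
    u ∈ realHyp (P.axes i) (P.axes i ⬝ᵥ P.center) ↔ P.coord u.ofLp i = 0 := by
  rw [coord_apply, sub_eq_zero]
  rfl

lemma realHyp_injective (P : PrincipalAxes q) :
    Function.Injective fun i => realHyp (P.axes i) (P.axes i ⬝ᵥ P.center) := by
  intro i j hij
  by_contra hne
  have h := Set.ext_iff.mp hij (WithLp.toLp 2 (P.point (Pi.single j 1)))
  rw [mem_realHyp_iff, mem_realHyp_iff] at h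
  simp [P.coord_point, hne] at h

variable (P) in
/-- The point with parameter `s` on the line from the centre (`s = 0`) through `u` (`s = 1`). -/
def ray (u : EuclideanSpace ℝ (Fin n)) (s : ℝ) : EuclideanSpace ℝ (Fin n) :=
  WithLp.toLp 2 (P.center + s • (u.ofLp - P.center))

lemma coord_ray (u : EuclideanSpace ℝ (Fin n)) (s : ℝ) :
    P.coord (P.ray u s).ofLp = s • P.coord u.ofLp := by
  simp [coord, ray, Matrix.mulVec_smul]

lemma tendsto_ray (u : EuclideanSpace ℝ (Fin n)) : Filter.Tendsto (P.ray u) (𝓝 1) (𝓝 u) := by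
  have hcont : Continuous (P.ray u) := by
    unfold ray
    fun_prop
  have h1 : P.ray u 1 = u := by simp [ray]
  simpa [h1] using hcont.tendsto 1

lemma slack_ray {i : Fin n} {u : EuclideanSpace ℝ (Fin n)}
    (hu : P.slack i (P.coord u.ofLp) = 0) (s : ℝ) :
    P.slack i (P.coord (P.ray u s).ofLp) = P.level / P.eig i * (1 - s ^ 2) := by
  rw [coord_ray, slack_smul, hu]
  ring

lemma coord_ray_eq_zero {i : Fin n} {u : EuclideanSpace ℝ (Fin n)} (hu : P.coord u.ofLp i = 0)
    (s : ℝ) : P.coord (P.ray u s).ofLp i = 0 := by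
  simp [coord_ray, hu]

lemma Regular.exists_pos (hP : P.Regular) (hV : (realV q).Nonempty) :
    ∃ k, 0 < P.eig k / P.level := by
  obtain ⟨x, hx⟩ := hV
  have h := P.quad_eq x.ofLp
  rw [show quad q x.ofLp = 0 from hx, eq_comm, sub_eq_zero] at h
  have hsum : ∑ j, P.eig j / P.level * P.coord x.ofLp j ^ 2 = 1 := by
    rw [← div_self hP.level_ne_zero]
    nth_rw 2 [← h]
    rw [Finset.sum_div]
    exact Finset.sum_congr rfl fun j _ => by ring
  by_contra! hall
  have := Finset.sum_nonpos fun j (_ : j ∈ Finset.univ) =>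
    mul_nonpos_of_nonpos_of_nonneg (hall j) (sq_nonneg (P.coord x.ofLp j))
  linarith

lemma Regular.core_nonempty (hP : P.Regular) (hV : (realV q).Nonempty) (i : Fin n) :
    (P.core i).Nonempty := by
  by_cases hi : 0 < P.level / P.eig i
  · refine ⟨WithLp.toLp 2 (P.point 0), ?_, ?_⟩
    · simp [P.coord_point]
    · simpa [P.coord_point, slack_zero] using hi
  obtain ⟨k, hk⟩ := hP.exists_pos hV
  have hneg : P.level / P.eig i < 0 :=
    lt_of_le_of_ne (not_lt.mp hi) (div_ne_zero hP.level_ne_zero (hP.eig_ne_zero i))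
  have hki : k ≠ i := by
    rintro rfl
    rw [← inv_div] at hneg
    exact (inv_pos.mpr hk).not_gt hneg
  have hdiv : 0 ≤ 2 * P.level / P.eig k := by
    rw [mul_div_assoc, ← inv_div]
    exact mul_nonneg zero_le_two (inv_nonneg.mpr hk.le)
  -- this makes the sum in the slack equal to `2 * level`
  let U : Fin n → ℝ :=
    Pi.single k ((1 - P.eig k / P.eig i) * √(2 * P.level / P.eig k))
  have hU : ∑ j ∈ Finset.univ.erase i, P.eig j * (U j / (1 - P.eig j / P.eig i)) ^ 2 =
      2 * P.level := by
    rw [Finset.sum_eq_single_of_mem k (by simpa using hki)]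
    · simp only [U, Pi.single_eq_same]
      rw [mul_div_cancel_left₀ _ (hP.one_sub_ne_zero hki), Real.sq_sqrt hdiv,
        mul_div_cancel₀ _ (hP.eig_ne_zero k)]
    · intro j _ hj
      simp [U, hj]
  refine ⟨WithLp.toLp 2 (P.point U), ?_, ?_⟩
  · simp [P.coord_point, U, hki.symm]
  · simp only [P.coord_point, slack, hU]
    have : (P.level - 2 * P.level) / P.eig i = -(P.level / P.eig i) := by ring
    rw [this]
    exact neg_pos.mpr hneg

lemma affineSpan_piece {i : Fin n} (hne : (P.core i).Nonempty) :
    (affineSpan ℝ (P.piece i) : Set (EuclideanSpace ℝ (Fin n))) =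
      realHyp (P.axes i) (P.axes i ⬝ᵥ P.center) := by
  apply subset_antisymm
  · let H : AffineSubspace ℝ (EuclideanSpace ℝ (Fin n)) :=
      { carrier := realHyp (P.axes i) (P.axes i ⬝ᵥ P.center)
        smul_vsub_vadd_mem' := by
          intro s x y z hx hy hz
          simp only [realHyp, Set.mem_ofPred_eq] at hx hy hz ⊢
          simp [dotProduct_add, dotProduct_sub, hx, hy, hz] }
    exact affineSpan_le (Q := H) |>.mpr fun u hu => (mem_realHyp_iff i u).mpr hu.1
  · intro u hu
    rw [mem_realHyp_iff] at hu
    obtain ⟨v, hv0, hv⟩ := hne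
    have hcont : Continuous fun t : ℝ => AffineMap.lineMap (k := ℝ) v u t :=
      AffineMap.lineMap_continuous
    have hlim := ((P.continuous_slack i).comp hcont).tendsto 0
    simp only [Function.comp_apply, AffineMap.lineMap_apply_zero] at hlim
    obtain ⟨t, ht, ht0⟩ := ((hlim.eventually (lt_mem_nhds hv)).filter_mono
      (nhdsWithin_le_nhds (s := {0}ᶜ)) |>.and self_mem_nhdsWithin).exists
    have hw : AffineMap.lineMap v u t ∈ P.piece i := by
      refine ⟨?_, ht.le⟩
      rw [coord_apply] at hu hv0 ⊢
      simp only [AffineMap.lineMap_apply, vsub_eq_sub, vadd_eq_add, WithLp.ofLp_add,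
        WithLp.ofLp_smul, WithLp.ofLp_sub, dotProduct_add, dotProduct_smul, dotProduct_sub,
        smul_eq_mul]
      linear_combination t * hu + (1 - t) * hv0
    have h := AffineMap.lineMap_mem (t⁻¹) (subset_affineSpan ℝ _ (core_subset_piece i ⟨hv0, hv⟩))
      (subset_affineSpan ℝ _ hw)
    rwa [AffineMap.lineMap_lineMap_right, inv_mul_cancel₀ ht0, AffineMap.lineMap_apply_one] at h

/-- Across a boundary point of a piece the slack changes sign along the ray from the centre. -/
lemma Regular.intrinsicInterior_piece (hP : P.Regular) {i : Fin n} (hne : (P.core i).Nonempty) :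
    intrinsicInterior ℝ (P.piece i) = P.core i := by
  ext u
  rw [mem_intrinsicInterior_iff_mem_nhdsWithin, ← SetLike.mem_coe, affineSpan_piece hne,
    mem_realHyp_iff]
  constructor
  · rintro ⟨hu0, hu⟩
    have hmem := mem_of_mem_nhdsWithin ((mem_realHyp_iff i u).mpr hu0) hu
    refine ⟨hu0, lt_of_le_of_ne hmem.2 fun h0 => ?_⟩
    have hev : ∀ᶠ s in 𝓝 (1 : ℝ), P.ray u s ∈ P.piece i :=
      (tendsto_nhdsWithin_of_tendsto_nhds_of_eventually_within _ (tendsto_ray u)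
        (Filter.Eventually.of_forall fun s =>
          (mem_realHyp_iff i _).mpr (coord_ray_eq_zero hu0 s))).eventually hu
    have hev' : ∀ᶠ s in 𝓝 (1 : ℝ), 0 ≤ P.level / P.eig i * (1 - s ^ 2) :=
      hev.mono fun s hs => slack_ray h0.symm s ▸ hs.2
    have hκ : P.level / P.eig i ≠ 0 := div_ne_zero hP.level_ne_zero (hP.eig_ne_zero i)
    rcases lt_or_gt_of_ne hκ with h | h
    · obtain ⟨s, hs, hs1⟩ := ((hev'.filter_mono (nhdsWithin_le_nhds (s := Set.Iio 1))).and
        (Ioo_mem_nhdsLT one_pos)).exists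
      nlinarith [hs1.1, hs1.2, mul_pos hs1.1 (sub_pos.mpr hs1.2)]
    · obtain ⟨s, hs, hs1⟩ := ((hev'.filter_mono (nhdsWithin_le_nhds (s := Set.Ioi 1))).and
        self_mem_nhdsWithin).exists
      have hs1 : 1 < s := hs1
      have : 1 - s ^ 2 < 0 := by nlinarith
      nlinarith
  · rintro ⟨hu0, hu⟩
    refine ⟨hu0, Filter.mem_of_superset (Filter.inter_mem self_mem_nhdsWithin
      (nhdsWithin_le_nhds ((P.continuous_slack i).continuousAt.eventually (lt_mem_nhds hu)))) ?_⟩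
    exact fun v hv => ⟨(mem_realHyp_iff i v).mp hv.1, le_of_lt hv.2⟩

lemma Regular.intrinsicFrontier_piece (hP : P.Regular) {i : Fin n} (hne : (P.core i).Nonempty) :
    intrinsicFrontier ℝ (P.piece i) =
      {u | P.coord u.ofLp i = 0 ∧ P.slack i (P.coord u.ofLp) = 0} := by
  rw [← intrinsicClosure_sdiff_intrinsicInterior, hP.intrinsicInterior_piece hne,
    ((isClosed_piece i).preimage continuous_subtype_val).intrinsicClosure]
  ext u
  simp only [piece, core, Set.mem_sdiff, Set.mem_ofPred_eq, not_and, not_lt]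
  exact ⟨fun h => ⟨h.1.1, le_antisymm (h.2 h.1.1) h.1.2⟩,
    fun h => ⟨⟨h.1, h.2.ge⟩, fun _ => h.2.le⟩⟩

lemma Regular.closure_core (hP : P.Regular) (i : Fin n) : closure (P.core i) = P.piece i := by
  apply subset_antisymm (closure_minimal (core_subset_piece i) (isClosed_piece i))
  rintro u ⟨hu0, hu⟩
  rcases hu.lt_or_eq with hu | hu
  · exact subset_closure ⟨hu0, hu⟩
  have hκ : P.level / P.eig i ≠ 0 := div_ne_zero hP.level_ne_zero (hP.eig_ne_zero i)
  rcases lt_or_gt_of_ne hκ with h | h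
  · refine mem_closure_of_tendsto ((tendsto_ray (P := P) u).mono_left
      (nhdsWithin_le_nhds (s := Set.Ioi 1))) (Filter.eventually_of_mem self_mem_nhdsWithin ?_)
    intro s hs
    have hs : 1 < s := hs
    refine ⟨coord_ray_eq_zero hu0 s, ?_⟩
    rw [slack_ray hu.symm]
    exact mul_pos_of_neg_of_neg h (by nlinarith)
  · refine mem_closure_of_tendsto ((tendsto_ray (P := P) u).mono_left
      (nhdsWithin_le_nhds (s := Set.Iio 1))) (Filter.eventually_of_mem
        (Ioo_mem_nhdsLT (one_pos (α := ℝ))) ?_)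
    intro s hs
    refine ⟨coord_ray_eq_zero hu0 s, ?_⟩
    rw [slack_ray hu.symm]
    exact mul_pos h (by nlinarith [hs.1, hs.2])

theorem Regular.closure_cutLocus (hP : P.Regular) (hV : (realV q).Nonempty) :
    closure (cutLocus (realV q)) = frontier (edRegion q) := by
  rw [hP.cutLocus_eq, hP.frontier_edRegion hV, hP.compl_edRegion hV, closure_iUnion_of_finite]
  exact Set.iUnion_congr fun i => hP.closure_core i.1

lemma Regular.disjoint_piece (hP : P.Regular) {i j : Fin n} (hi : P.IsExtreme i)
    (hj : P.IsExtreme j) (hij : i ≠ j) : Disjoint (P.piece i) (P.piece j) := by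
  rw [Set.disjoint_left]
  rintro u ⟨hui0, hui⟩ ⟨huj0, huj⟩
  obtain ⟨x, hx, hxu, -⟩ := hP.exists_preimage hui0 (Real.sq_sqrt hui)
  obtain ⟨y, hy, hyu, -⟩ := hP.exists_preimage huj0 (Real.sq_sqrt huj)
  have hxn := isNearest_of_posSemidef hx (hi.posSemidef hP) hxu
  have hyn := isNearest_of_posSemidef hy (hj.posSemidef hP) hyu
  have key : ∀ (k : Fin n), P.IsExtreme k → ∀ z w : EuclideanSpace ℝ (Fin n),
      IsNearest (realV q) u z → IsNearest (realV q) u w →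
      u.ofLp = z.ofLp - (P.eig k)⁻¹ • halfGrad q z.ofLp →
      ∀ m, m ≠ k → P.coord w.ofLp m = P.coord z.ofLp m := by
    intro k hk z w hz hw hzu m hm
    have h0 := hessian_form_sub_eq_zero hz hw hzu
    rw [P.hessian_form_eq, Finset.sum_eq_zero_iff_of_nonneg fun j _ =>
      mul_nonneg ((P.posSemidef_iff _).mp (hk.posSemidef hP) j) (sq_nonneg _)] at h0
    have h1 := (mul_eq_zero.mp (h0 m (Finset.mem_univ m))).resolve_left (by
      rw [← div_eq_inv_mul]; exact hP.one_sub_ne_zero hm)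
    exact sub_eq_zero.mp (pow_eq_zero_iff two_ne_zero |>.mp h1)
  have hxy : x.ofLp = y.ofLp := by
    refine P.coord_injective (funext fun m => ?_)
    by_cases hm : m = i
    · exact key j hj y x hyn hxn hyu m (hm ▸ hij)
    · exact (key i hi x y hxn hyn hxu m hm).symm
  rw [hxu, hxy, sub_right_inj] at hyu
  exact hij (hP.eig_injective (inv_injective
    (smul_left_injective ℝ (hP.halfGrad_ne_zero (x := y.ofLp) hy) hyu)))

lemma Regular.isBoundedByQuadricIn_piece (hP : P.Regular) {i k : Fin n} (hik : k ≠ i)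
    (hne : (P.core i).Nonempty) :
    IsBoundedByQuadricIn (P.piece i) (P.axes i) (P.axes i ⬝ᵥ P.center) := by
  refine ⟨affineSpan_piece hne, P.slackCoeffs i, ⟨P.axes k, ?_, ?_⟩, ?_, ?_⟩
  · rw [axes_dotProduct_axes, if_neg hik.symm]
  · have h : P.axes *ᵥ P.axes k = Pi.single k 1 := by
      ext j
      exact (P.axes_dotProduct_axes j k).trans (by simp [Pi.single_apply])
    rw [slackCoeffs, matA_ofParts, dotProduct_ofDiagonal_mulVec, h]
    simp [Pi.single_apply, hik, hP.eig_ne_zero, hP.one_sub_ne_zero hik]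
  · ext u
    simp only [piece, Set.mem_ofPred_eq, mem_realHyp_iff, quad_slackCoeffs, neg_nonpos]
  · rw [hP.intrinsicFrontier_piece hne]
    ext u
    simp only [Set.mem_ofPred_eq, mem_realHyp_iff, quad_slackCoeffs, neg_eq_zero]

/-! ### Ellipsoids -/

lemma isEllipsoid_of_pos (hpos : ∀ j, 0 < P.eig j / P.level) (hlevel : P.level ≠ 0) :
    IsEllipsoid (realV q) := by
  refine ⟨WithLp.toLp 2 P.center, P.ofDiagonal fun j => P.eig j / P.level,
    posDef_ofDiagonal hpos, ?_⟩
  ext x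
  have h := P.quad_eq x.ofLp
  have hs : ∑ j, P.eig j / P.level * P.coord x.ofLp j ^ 2 =
      (∑ j, P.eig j * P.coord x.ofLp j ^ 2) / P.level := by
    rw [Finset.sum_div]
    exact Finset.sum_congr rfl fun j _ => by ring
  simp only [realV, Set.mem_ofPred_eq, WithLp.ofLp_sub, dotProduct_ofDiagonal_mulVec, h]
  rw [sub_eq_zero, ← div_eq_one_iff_eq hlevel, ← hs]
  rfl

/-- A quadric with eigenvalues of both signs contains a curve that escapes to infinity; the
defining form of an ellipsoid would have to vanish on the asymptotic direction of the curve. -/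
lemma Regular.pos_of_isEllipsoid (hP : P.Regular) (hV : (realV q).Nonempty)
    (hE : IsEllipsoid (realV q)) (i : Fin n) : 0 < P.eig i / P.level := by
  by_contra! hi
  replace hi : P.eig i / P.level < 0 :=
    lt_of_le_of_ne hi (div_ne_zero (hP.eig_ne_zero i) hP.level_ne_zero)
  obtain ⟨p, Q, hQ, hVQ⟩ := hE
  obtain ⟨k, hk0⟩ := hP.exists_pos hV
  have hki : k ≠ i := fun h => (h ▸ hk0).not_gt hi
  -- `ε` times the difference of the point of the curve with parameter `1 / ε` and the centre
  let Y : ℝ → Fin n → ℝ := fun ε => Pi.single i 1 +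
    Pi.single k (√((ε ^ 2 - P.eig i / P.level) / (P.eig k / P.level)))
  let y : ℝ → Fin n → ℝ := fun ε => ε • (P.center - p.ofLp) + P.axesᵀ *ᵥ Y ε
  have hYc : Continuous Y := by
    refine continuous_const.add (continuous_pi fun j => ?_)
    simp only [Pi.single_apply]
    split_ifs <;> fun_prop
  have hyc : Continuous y := by
    refine Continuous.add (by fun_prop) (Continuous.matrix_mulVec continuous_const hYc)
  have hF : Continuous fun ε => y ε ⬝ᵥ (Q *ᵥ y ε) - ε ^ 2 :=
    (hyc.dotProduct (continuous_const.matrix_mulVec hyc)).sub (by fun_prop)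
  have hcurve : ∀ ε : ℝ, 0 < ε → y ε ⬝ᵥ (Q *ᵥ y ε) - ε ^ 2 = 0 := by
    intro ε hε
    have hsq : √((ε ^ 2 - P.eig i / P.level) / (P.eig k / P.level)) ^ 2 =
        (ε ^ 2 - P.eig i / P.level) / (P.eig k / P.level) :=
      Real.sq_sqrt (div_nonneg (by nlinarith [sq_nonneg ε]) hk0.le)
    have hmem : WithLp.toLp 2 (P.point (ε⁻¹ • Y ε)) ∈ realV q := by
      change quad q (P.point (ε⁻¹ • Y ε)) = 0
      rw [P.quad_eq, P.coord_point, sub_eq_zero]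
      have hterm : ∀ j, P.eig j * (ε⁻¹ • Y ε) j ^ 2 = (ε⁻¹) ^ 2 *
          ((Pi.single i (P.eig i) : Fin n → ℝ) j + (Pi.single k (P.eig k *
            √((ε ^ 2 - P.eig i / P.level) / (P.eig k / P.level)) ^ 2) : Fin n → ℝ) j) := by
        intro j
        by_cases h1 : j = i
        · subst h1
          simp [Y, hki.symm]
          ring
        · by_cases h2 : j = k
          · subst h2
            simp [Y, hki]
            ring
          · simp [Y, h1, h2]
      have h1 := hP.level_ne_zero
      have h2 := hP.eig_ne_zero k
      simp only [hterm, ← Finset.mul_sum, Finset.sum_add_distrib, Finset.sum_pi_single',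
        Finset.mem_univ, if_true, hsq]
      field_simp
      ring
    rw [hVQ] at hmem
    have hy : (WithLp.toLp 2 (P.point (ε⁻¹ • Y ε)) - p).ofLp = ε⁻¹ • y ε := by
      simp only [WithLp.ofLp_sub, point, y, Matrix.mulVec_smul, smul_add, smul_smul,
        inv_mul_cancel₀ hε.ne', one_smul]
      abel
    rw [Set.mem_ofPred_eq, hy, Matrix.mulVec_smul, dotProduct_smul, smul_dotProduct,
      smul_eq_mul, smul_eq_mul] at hmem
    field_simp at hmem
    linarith
  have hlim : Filter.Tendsto (fun ε => y ε ⬝ᵥ (Q *ᵥ y ε) - ε ^ 2) (𝓝[>] 0)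
      (𝓝 (y 0 ⬝ᵥ (Q *ᵥ y 0) - 0 ^ 2)) := (hF.tendsto 0).mono_left nhdsWithin_le_nhds
  have h0 : y 0 ⬝ᵥ (Q *ᵥ y 0) - 0 ^ 2 = 0 := by
    refine tendsto_nhds_unique hlim (tendsto_const_nhds.congr' ?_)
    exact Filter.eventually_of_mem self_mem_nhdsWithin fun ε hε => (hcurve ε hε).symm
  have hy0 : y 0 ≠ 0 := by
    intro h
    have h1 : P.axes *ᵥ y 0 = 0 := by rw [h, Matrix.mulVec_zero]
    simp only [y, zero_smul, zero_add, Matrix.mulVec_mulVec, P.axes_mul_transpose,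
      Matrix.one_mulVec] at h1
    have h2 := congrFun h1 i
    simp [Y, hki.symm] at h2
  have := hQ.dotProduct_mulVec_pos hy0
  rw [star_trivial] at this
  linarith

lemma Regular.isExtreme_of_forall_le (hP : P.Regular) {i : Fin n}
    (hi : 0 < P.eig i / P.level) (h : ∀ j, P.eig j / P.level ≤ P.eig i / P.level) :
    P.IsExtreme i := by
  intro j hj
  have h1 : P.eig j / P.eig i = (P.eig j / P.level) / (P.eig i / P.level) :=
    (div_div_div_cancel_right₀ hP.level_ne_zero _ _).symm
  refine lt_of_le_of_ne ?_ (sub_ne_zero.mp (hP.one_sub_ne_zero hj)).symm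
  rw [h1]
  exact div_le_one_of_le₀ (h j) hi.le

lemma Regular.isExtreme_of_forall_ge (hP : P.Regular) {i : Fin n}
    (hi : P.eig i / P.level < 0) (h : ∀ j, P.eig i / P.level ≤ P.eig j / P.level) :
    P.IsExtreme i := by
  intro j hj
  have h1 : P.eig j / P.eig i = (P.eig j / P.level) / (P.eig i / P.level) :=
    (div_div_div_cancel_right₀ hP.level_ne_zero _ _).symm
  refine lt_of_le_of_ne ?_ (sub_ne_zero.mp (hP.one_sub_ne_zero hj)).symm
  rw [h1]
  exact (div_le_one_of_neg hi).mpr (h j)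

lemma IsExtreme.eq_of_pos (hP : P.Regular) {i k : Fin n} (hk : P.IsExtreme k)
    (hk0 : 0 < P.eig k / P.level) (h : ∀ j, P.eig j / P.level ≤ P.eig i / P.level) : k = i := by
  by_contra hne
  have h1 := hk i (Ne.symm hne)
  rw [← div_div_div_cancel_right₀ hP.level_ne_zero, div_lt_one hk0] at h1
  exact (h k).not_gt h1

lemma IsExtreme.eq_of_neg (hP : P.Regular) {i k : Fin n} (hk : P.IsExtreme k)
    (hk0 : P.eig k / P.level < 0) (h : ∀ j, P.eig i / P.level ≤ P.eig j / P.level) : k = i := by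
  by_contra hne
  have h1 := hk i (Ne.symm hne)
  rw [← div_div_div_cancel_right₀ hP.level_ne_zero, div_lt_one_of_neg hk0] at h1
  exact (h k).not_gt h1

theorem Regular.ellipsoid_case (hP : P.Regular) (hV : (realV q).Nonempty)
    (hE : IsEllipsoid (realV q)) :
    (∃ i, IsSolidEllipsoidIn (frontier (edRegion q))
      (realHyp (P.axes i) (P.axes i ⬝ᵥ P.center))) ∧
    cutLocus (realV q) = intrinsicInterior ℝ (frontier (edRegion q)) := by
  have hpos := hP.pos_of_isEllipsoid hV hE
  obtain ⟨k, -⟩ := hP.exists_pos hV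
  have : Nonempty (Fin n) := ⟨k⟩
  obtain ⟨i, hi⟩ := Finite.exists_max fun j => P.eig j / P.level
  have hext := hP.isExtreme_of_forall_le (hpos i) hi
  have huniq : ∀ k : {k // P.IsExtreme k}, k = ⟨i, hext⟩ := fun k =>
    Subtype.ext (k.2.eq_of_pos hP (hpos _) hi)
  have hunion : ∀ s : Fin n → Set (EuclideanSpace ℝ (Fin n)),
      ⋃ k : {k // P.IsExtreme k}, s k = s i := by
    intro s
    refine subset_antisymm (Set.iUnion_subset fun k => by rw [huniq k])
      (Set.subset_iUnion (fun k : {k // P.IsExtreme k} => s k) ⟨i, hext⟩)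
  have hfr : frontier (edRegion q) = P.piece i := by
    rw [hP.frontier_edRegion hV, hP.compl_edRegion hV, hunion]
  have hcut : cutLocus (realV q) = P.core i := by
    rw [hP.cutLocus_eq, hunion]
  rw [hfr, hcut, hP.intrinsicInterior_piece (hP.core_nonempty hV i)]
  refine ⟨⟨i, WithLp.toLp 2 P.center, ?_, P.ofDiagonal fun j =>
    if j = i then 1 else P.eig j / P.level / (1 - P.eig j / P.eig i) ^ 2,
    posDef_ofDiagonal fun j => ?_, ?_⟩, rfl⟩
  · simp [mem_realHyp_iff, coord]
  · split_ifs with h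
    · exact one_pos
    · exact div_pos (hpos j) (sq_pos_iff.mpr (hP.one_sub_ne_zero h))
  · ext u
    simp only [piece, Set.mem_ofPred_eq, mem_realHyp_iff, dotProduct_ofDiagonal_mulVec]
    refine and_congr_right fun hu => ?_
    have hu' : (P.axes *ᵥ (u - WithLp.toLp 2 P.center).ofLp) = P.coord u.ofLp := rfl
    have hκ : 0 < P.level / P.eig i := by
      rw [← inv_div]
      exact inv_pos.mpr (hpos i)
    have hs : P.slack i (P.coord u.ofLp) = P.level / P.eig i *
        (1 - ∑ j, (if j = i then 1 else P.eig j / P.level / (1 - P.eig j / P.eig i) ^ 2) *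
          P.coord u.ofLp j ^ 2) := by
      rw [← Finset.add_sum_erase Finset.univ _ (Finset.mem_univ i), hu, slack, mul_sub,
        zero_pow two_ne_zero, mul_zero, zero_add, Finset.mul_sum, sub_div, Finset.sum_div, mul_one]
      congr 1
      refine Finset.sum_congr rfl fun j hj => ?_
      rw [if_neg (Finset.ne_of_mem_erase hj)]
      have h1 := hP.level_ne_zero
      have h2 := hP.one_sub_ne_zero (Finset.ne_of_mem_erase hj)
      generalize 1 - P.eig j / P.eig i = d at *
      field_simp
    rw [hu', hs, mul_nonneg_iff_of_pos_left hκ, sub_nonneg]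

theorem Regular.not_ellipsoid_case (hP : P.Regular) (hV : (realV q).Nonempty)
    (hE : ¬IsEllipsoid (realV q)) :
    ∃ (i j : Fin n) (B₁ B₂ : Set (EuclideanSpace ℝ (Fin n))), i ≠ j ∧
      frontier (edRegion q) = B₁ ∪ B₂ ∧ Disjoint B₁ B₂ ∧
      IsBoundedByQuadricIn B₁ (P.axes i) (P.axes i ⬝ᵥ P.center) ∧
      IsBoundedByQuadricIn B₂ (P.axes j) (P.axes j ⬝ᵥ P.center) ∧
      cutLocus (realV q) = intrinsicInterior ℝ B₁ ∪ intrinsicInterior ℝ B₂ := by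
  obtain ⟨k, hk⟩ := hP.exists_pos hV
  have : Nonempty (Fin n) := ⟨k⟩
  obtain ⟨m, hm⟩ : ∃ m, P.eig m / P.level < 0 := by
    by_contra! hall
    exact hE (isEllipsoid_of_pos (fun j => lt_of_le_of_ne (hall j)
      (div_ne_zero (hP.eig_ne_zero j) hP.level_ne_zero).symm) hP.level_ne_zero)
  obtain ⟨i, hi⟩ := Finite.exists_max fun j => P.eig j / P.level
  obtain ⟨j, hj⟩ := Finite.exists_min fun j => P.eig j / P.level
  have hi0 : 0 < P.eig i / P.level := hk.trans_le (hi k)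
  have hj0 : P.eig j / P.level < 0 := (hj m).trans_lt hm
  have hij : i ≠ j := fun h => (h ▸ hi0).not_gt hj0
  have hexti := hP.isExtreme_of_forall_le hi0 hi
  have hextj := hP.isExtreme_of_forall_ge hj0 hj
  have hunion : ∀ s : Fin n → Set (EuclideanSpace ℝ (Fin n)),
      ⋃ k : {k // P.IsExtreme k}, s k = s i ∪ s j := by
    intro s
    apply subset_antisymm
    · refine Set.iUnion_subset fun ⟨k, hk⟩ => ?_
      change s k ⊆ _
      rcases lt_or_gt_of_ne (div_ne_zero (hP.eig_ne_zero k) hP.level_ne_zero) with h | h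
      · rw [hk.eq_of_neg hP h hj]
        exact Set.subset_union_right
      · rw [hk.eq_of_pos hP h hi]
        exact Set.subset_union_left
    · exact Set.union_subset (Set.subset_iUnion (fun k : {k // P.IsExtreme k} => s k) ⟨i, hexti⟩)
        (Set.subset_iUnion (fun k : {k // P.IsExtreme k} => s k) ⟨j, hextj⟩)
  refine ⟨i, j, P.piece i, P.piece j, hij, ?_, hP.disjoint_piece hexti hextj hij,
    hP.isBoundedByQuadricIn_piece hij.symm (hP.core_nonempty hV i),
    hP.isBoundedByQuadricIn_piece hij (hP.core_nonempty hV j), ?_⟩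
  · rw [hP.frontier_edRegion hV, hP.compl_edRegion hV, hunion]
  · rw [hP.cutLocus_eq, hP.intrinsicInterior_piece (hP.core_nonempty hV i),
      hP.intrinsicInterior_piece (hP.core_nonempty hV j), hunion]

end PrincipalAxes

/-! ### The image of the complex quadric -/

/-- The restriction of a polynomial function to a line is a polynomial function. -/
lemma exists_polynomial_eval_line {n : ℕ} {K : Type*} [Field K] [Algebra K ℂ]
    (p : MvPolynomial (Fin n) K) (z d : Fin n → ℂ) :
    ∃ f : Polynomial ℂ, ∀ t : ℂ, f.eval t = MvPolynomial.aeval (z + t • d) p := by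
  refine ⟨MvPolynomial.aeval (fun i => Polynomial.C (z i) + Polynomial.X * Polynomial.C (d i)) p,
    fun t => ?_⟩
  rw [← Polynomial.coe_aeval_eq_eval, ← AlgHom.restrictScalars_apply K, ← AlgHom.comp_apply,
    MvPolynomial.comp_aeval]
  congr 2
  ext i
  simp
  exact mul_comm _ _

namespace PrincipalAxes

variable {n : ℕ}

section Complex

variable {q : Coeffs n ℝ} {P : PrincipalAxes (toComplex q)}

lemma mem_detLocus_iff (l : ℂ) : l ∈ detLocus q ↔ ∃ i, 1 - l * P.eig i = 0 := by
  rw [detLocus, Set.mem_ofPred_eq, P.det_hessian, Finset.prod_eq_zero_iff]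
  simp

lemma Regular.mem_detLocus_iff (hP : P.Regular) (l : ℂ) :
    l ∈ detLocus q ↔ ∃ i, l = (P.eig i)⁻¹ := by
  rw [P.mem_detLocus_iff]
  refine exists_congr fun i => ⟨fun h => eq_inv_of_mul_eq_one_left (sub_eq_zero.mp h).symm, ?_⟩
  rintro rfl
  rw [inv_mul_cancel₀ (hP.eig_ne_zero i), sub_self]

lemma Regular.piMap_eq_iff (hP : P.Regular) (i : Fin n) (x u : Fin n → ℂ) :
    x ∈ complexV q ∧ piMap q (x, (P.eig i)⁻¹) = u ↔
      P.coord u i = 0 ∧ (∀ j, j ≠ i → P.coord x j = P.coord u j / (1 - P.eig j / P.eig i)) ∧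
        P.coord x i ^ 2 = P.slack i (P.coord u) := by
  rw [← hP.quad_eq_zero_and_coord_eq_iff i x u, eq_comm (a := u)]
  rfl

variable (P) in
/-- A point with the coordinates of a preimage of `u` for the multiplier `1 / eigᵢ`, except that
the coordinate in direction of the `i`-th axis is `r`. -/
noncomputable def lift (i : Fin n) (u : Fin n → ℂ) (r : ℂ) : Fin n → ℂ :=
  P.point fun j => if j = i then r else P.coord u j / (1 - P.eig j / P.eig i)

lemma Regular.fiber_eq (hP : P.Regular) {i : Fin n} {u : Fin n → ℂ} {r : ℂ}
    (hu : P.coord u i = 0) (hr : r ^ 2 = P.slack i (P.coord u)) (x : Fin n → ℂ) :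
    x ∈ complexV q ∧ piMap q (x, (P.eig i)⁻¹) = u ↔ x = P.lift i u r ∨ x = P.lift i u (-r) := by
  rw [hP.piMap_eq_iff, ← hr, sq_eq_sq_iff_eq_or_eq_neg]
  have key : ∀ s : ℂ, x = P.lift i u s ↔ P.coord x i = s ∧
      ∀ j, j ≠ i → P.coord x j = P.coord u j / (1 - P.eig j / P.eig i) := by
    intro s
    rw [← P.coord_injective.eq_iff, lift, P.coord_point, funext_iff]
    refine ⟨fun h => ⟨by rw [h, if_pos rfl], fun j hj => by rw [h, if_neg hj]⟩, fun h j => ?_⟩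
    by_cases hj : j = i
    · rw [if_pos hj, hj, h.1]
    · rw [if_neg hj, h.2 j hj]
  rw [key, key]
  tauto

lemma Regular.image_piMap_singleton (hP : P.Regular) (i : Fin n) (u : Fin n → ℂ) :
    (∃ x ∈ complexV q, piMap q (x, (P.eig i)⁻¹) = u) ↔ P.coord u i = 0 := by
  constructor
  · rintro ⟨x, hx⟩
    exact ((hP.piMap_eq_iff i x u).mp hx).1
  · intro hu
    obtain ⟨r, hr⟩ := IsAlgClosed.exists_pow_nat_eq (P.slack i (P.coord u)) two_pos
    exact ⟨P.lift i u r, (hP.fiber_eq hu hr _).mpr (Or.inl rfl)⟩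

variable (P) in
/-- The `j`-th coordinate along the principal axes as a polynomial. -/
noncomputable def coordPoly (j : Fin n) : MvPolynomial (Fin n) ℂ :=
  ∑ k, MvPolynomial.C (P.axes j k) * MvPolynomial.X k - MvPolynomial.C (P.axes j ⬝ᵥ P.center)

lemma eval_coordPoly (j : Fin n) (u : Fin n → ℂ) :
    MvPolynomial.eval u (P.coordPoly j) = P.coord u j := by
  simp [coordPoly, coord_apply, dotProduct]

variable (P) in
/-- A polynomial which on each of the hyperplanes `uᵢ = 0` (in principal coordinates) is the
product of the slack and of the other coordinates. -/
noncomputable def genericityPolyOnHyperplanes : MvPolynomial (Fin n) ℂ :=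
  ∑ i, (∏ j ∈ Finset.univ.erase i, P.coordPoly j) *
    (MvPolynomial.C (P.eig i)⁻¹ * (MvPolynomial.C P.level - ∑ j ∈ Finset.univ.erase i,
      MvPolynomial.C (P.eig j * ((1 - P.eig j / P.eig i)⁻¹) ^ 2) * P.coordPoly j ^ 2))

lemma eval_genericityPolyOnHyperplanes {i : Fin n} {u : Fin n → ℂ} (hu : P.coord u i = 0) :
    MvPolynomial.eval u P.genericityPolyOnHyperplanes =
      (∏ j ∈ Finset.univ.erase i, P.coord u j) * P.slack i (P.coord u) := by
  simp only [genericityPolyOnHyperplanes, map_sum, map_mul, map_prod, map_sub, map_pow,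
    eval_coordPoly, MvPolynomial.eval_C]
  rw [Finset.sum_eq_single_of_mem i (Finset.mem_univ i)]
  · rw [slack, div_eq_inv_mul]
    congr 3
    refine Finset.sum_congr rfl fun j _ => ?_
    ring
  · intro k _ hk
    rw [Finset.prod_eq_zero (Finset.mem_erase.mpr ⟨hk.symm, Finset.mem_univ i⟩) hu, zero_mul]

lemma Regular.exists_generic_point (hP : P.Regular) (i : Fin n) :
    ∃ u : Fin n → ℂ, P.coord u i = 0 ∧
      MvPolynomial.eval u P.genericityPolyOnHyperplanes ≠ 0 := by
  let U : Fin n → ℂ := fun j => if j = i then 0 else 1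
  -- at least one of `U` and `2 U` has nonzero slack
  obtain ⟨s, hs0, hs⟩ : ∃ s : ℂ, s ≠ 0 ∧ P.slack i (s • U) ≠ 0 := by
    by_contra! h
    have h1 := h 1 one_ne_zero
    have h2 := h 2 two_ne_zero
    rw [slack_smul] at h1 h2
    have h3 : 3 * (P.level / P.eig i) = 0 := by linear_combination 4 * h1 - h2
    rcases mul_eq_zero.mp h3 with h4 | h4
    · norm_num at h4
    · exact div_ne_zero hP.level_ne_zero (hP.eig_ne_zero i) h4
  have hi : P.coord (P.point (s • U)) i = 0 := by simp [P.coord_point, U]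
  refine ⟨P.point (s • U), hi, ?_⟩
  rw [eval_genericityPolyOnHyperplanes hi, P.coord_point]
  refine mul_ne_zero (Finset.prod_ne_zero_iff.mpr fun j hj => ?_) hs
  simp [U, Finset.ne_of_mem_erase hj, hs0]

/-- Over a generic point of the hyperplane `uᵢ = 0`, only the multiplier `1 / eigᵢ` occurs, and
there are two preimages, which differ in the sign of their `i`-th coordinate. -/
theorem Regular.hasDegree_two (hP : P.Regular) {T : Set ℂ} (hT : T ⊆ detLocus q) :
    HasDegree (complexV q ×ˢ T) (piMap q) 2 := by
  refine ⟨P.genericityPolyOnHyperplanes, ?_, ?_⟩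
  · rintro _ ⟨⟨x, l⟩, ⟨hx, hl⟩, rfl⟩
    obtain ⟨i, rfl⟩ := (hP.mem_detLocus_iff l).mp (hT hl)
    have hz := (hP.image_piMap_singleton i _).mp ⟨x, hx, rfl⟩
    set z := piMap q (x, (P.eig i)⁻¹)
    obtain ⟨z₀, hz₀, hgen⟩ := hP.exists_generic_point i
    intro p hp
    obtain ⟨f, hf⟩ := exists_polynomial_eval_line p z₀ (z - z₀)
    obtain ⟨g, hg⟩ := exists_polynomial_eval_line P.genericityPolyOnHyperplanes z₀ (z - z₀)
    have hline : ∀ t : ℂ, P.coord (z₀ + t • (z - z₀)) i = 0 := by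
      intro t
      rw [coord_apply] at hz hz₀ ⊢
      rw [dotProduct_add, dotProduct_smul, dotProduct_sub, smul_eq_mul]
      linear_combination t * hz + (1 - t) * hz₀
    have hfg : f * g = 0 := by
      refine Polynomial.funext fun t => ?_
      rw [Polynomial.eval_mul, Polynomial.eval_zero, hf, hg, MvPolynomial.aeval_eq_eval]
      by_cases h : MvPolynomial.eval (z₀ + t • (z - z₀)) P.genericityPolyOnHyperplanes = 0
      · exact mul_eq_zero_of_right _ h
      · obtain ⟨y, hy, hyu⟩ := (hP.image_piMap_singleton i _).mpr (hline t)
        exact mul_eq_zero_of_left (hp _ ⟨⟨(y, _), ⟨hy, hl⟩, hyu⟩, h⟩) _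
    rcases mul_eq_zero.mp hfg with h | h
    · have := hf 1
      rwa [h, Polynomial.eval_zero, one_smul, add_sub_cancel, eq_comm] at this
    · have := hg 0
      rw [h, Polynomial.eval_zero, zero_smul, add_zero, MvPolynomial.aeval_eq_eval] at this
      exact absurd this.symm hgen
  · rintro _ ⟨⟨x, l⟩, ⟨hx, hl⟩, rfl⟩ hgen
    obtain ⟨i, rfl⟩ := (hP.mem_detLocus_iff l).mp (hT hl)
    have hz := (hP.image_piMap_singleton i _).mp ⟨x, hx, rfl⟩
    set u := piMap q (x, (P.eig i)⁻¹)
    rw [eval_genericityPolyOnHyperplanes hz, mul_ne_zero_iff, Finset.prod_ne_zero_iff] at hgen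
    obtain ⟨r, hr⟩ := IsAlgClosed.exists_pow_nat_eq (P.slack i (P.coord u)) two_pos
    have hr0 : r ≠ 0 := by
      rintro rfl
      exact hgen.2 (by rw [← hr]; simp)
    have hset : {p | p ∈ complexV q ×ˢ T ∧ piMap q p = u} =
        {(P.lift i u r, (P.eig i)⁻¹), (P.lift i u (-r), (P.eig i)⁻¹)} := by
      ext ⟨y, m⟩
      simp only [Set.mem_ofPred_eq, Set.mem_prod, Set.mem_insert_iff, Set.mem_singleton_iff,
        Prod.mk.injEq]
      constructor
      · rintro ⟨⟨hy, hm⟩, hyu⟩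
        obtain ⟨k, rfl⟩ := (hP.mem_detLocus_iff m).mp (hT hm)
        have hk : k = i := by
          by_contra hne
          exact hgen.1 k (Finset.mem_erase.mpr ⟨hne, Finset.mem_univ k⟩)
            ((hP.image_piMap_singleton k u).mp ⟨y, hy, hyu⟩)
        subst hk
        rcases (hP.fiber_eq hz hr y).mp ⟨hy, hyu⟩ with h | h
        · exact Or.inl ⟨h, rfl⟩
        · exact Or.inr ⟨h, rfl⟩
      · rintro (⟨rfl, rfl⟩ | ⟨rfl, rfl⟩)
        · have := (hP.fiber_eq hz hr _).mpr (Or.inl rfl)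
          exact ⟨⟨this.1, hl⟩, this.2⟩
        · have := (hP.fiber_eq hz hr _).mpr (Or.inr rfl)
          exact ⟨⟨this.1, hl⟩, this.2⟩
    rw [hset, Set.ncard_pair]
    intro h
    have h1 := congrArg (fun y => P.coord y.1 i) h
    simp only [lift, P.coord_point, if_pos] at h1
    exact hr0 (self_eq_neg.mp h1)

end Complex

section Real

open Topology

variable {q : Coeffs n ℝ} {P : PrincipalAxes q}

variable (P) in
/-- Real principal axes, viewed over the complex numbers. -/
def complex : PrincipalAxes (toComplex q) := P.map Complex.ofRealHom

lemma complex_eig (i : Fin n) : P.complex.eig i = (P.eig i : ℂ) := rfl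

lemma Regular.complex (hP : P.Regular) : P.complex.Regular where
  eig_injective := Complex.ofReal_injective.comp hP.eig_injective
  eig_ne_zero i := Complex.ofReal_ne_zero.mpr (hP.eig_ne_zero i)
  level_ne_zero := by
    have : P.complex.level = (P.level : ℂ) := P.level_map Complex.ofRealHom
    rw [this]
    exact Complex.ofReal_ne_zero.mpr hP.level_ne_zero

lemma mem_complexHyp_iff (i : Fin n) (z : Fin n → ℂ) :
    z ∈ complexHyp (P.axes i) (P.axes i ⬝ᵥ P.center) ↔ P.complex.coord z i = 0 := by
  rw [coord_apply, sub_eq_zero, complexHyp, Set.mem_ofPred_eq]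
  have : ((P.axes i ⬝ᵥ P.center : ℝ) : ℂ) = P.complex.axes i ⬝ᵥ P.complex.center := by
    simp [PrincipalAxes.complex, map, dotProduct]
  rw [this]
  rfl

theorem Regular.image_piMap (hP : P.Regular) :
    piMap q '' (complexV q ×ˢ detLocus q) =
      ⋃ i, complexHyp (P.axes i) (P.axes i ⬝ᵥ P.center) := by
  ext u
  simp only [Set.mem_iUnion, mem_complexHyp_iff, ← hP.complex.image_piMap_singleton]
  constructor
  · rintro ⟨⟨x, l⟩, ⟨hx, hl⟩, rfl⟩
    obtain ⟨i, rfl⟩ := (hP.complex.mem_detLocus_iff l).mp hl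
    exact ⟨i, x, hx, rfl⟩
  · rintro ⟨i, x, hx, rfl⟩
    exact ⟨(x, _), ⟨hx, (hP.complex.mem_detLocus_iff _).mpr ⟨i, rfl⟩⟩, rfl⟩

lemma coord_complexify (u : EuclideanSpace ℝ (Fin n)) (i : Fin n) :
    P.complex.coord (fun j => (u j : ℂ)) i = (P.coord u.ofLp i : ℂ) := by
  rw [coord_apply, coord_apply]
  simp [PrincipalAxes.complex, map, dotProduct]

lemma mem_detLocus_of_mem_frontier (P : PrincipalAxes q) {l : ℝ}
    (hl : l ∈ frontier (masterSpec q)) : (l : ℂ) ∈ detLocus q := by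
  have hS : masterSpec q = ⋂ j, {l : ℝ | 0 < 1 - l * P.eig j} := by
    ext l
    simp [masterSpec, P.posDef_iff]
  have hopen : IsOpen (masterSpec q) := by
    rw [hS]
    exact isOpen_iInter_of_finite fun j => isOpen_lt continuous_const (by fun_prop)
  have hclosed : IsClosed (⋂ j, {l : ℝ | 0 ≤ 1 - l * P.eig j}) :=
    isClosed_iInter fun j => isClosed_le continuous_const (by fun_prop)
  rw [hopen.frontier_eq] at hl
  have h1 : ∀ j, 0 ≤ 1 - l * P.eig j := by
    have := closure_minimal (s := masterSpec q) (fun l hl => Set.mem_iInter.mpr fun j =>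
      ((P.posDef_iff l).mp hl j).le) hclosed hl.1
    exact Set.mem_iInter.mp this
  have h2 := hl.2
  rw [hS] at h2
  simp only [Set.mem_iInter, Set.mem_ofPred_eq, not_forall, not_lt] at h2
  obtain ⟨i, hi⟩ := h2
  rw [P.complex.mem_detLocus_iff]
  refine ⟨i, ?_⟩
  rw [complex_eig]
  exact_mod_cast le_antisymm hi (h1 i)

lemma Regular.inv_eig_mem_frontier (hP : P.Regular) {i : Fin n} (hi : P.IsExtreme i) :
    (P.eig i)⁻¹ ∈ frontier (masterSpec q) := by
  constructor
  · have hlim : Filter.Tendsto (fun t : ℝ => t * (P.eig i)⁻¹) (𝓝[<] 1) (𝓝 (P.eig i)⁻¹) := by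
      have hcont : Continuous fun t : ℝ => t * (P.eig i)⁻¹ := by fun_prop
      simpa using (hcont.tendsto 1).mono_left (nhdsWithin_le_nhds (s := Set.Iio 1))
    refine mem_closure_of_tendsto hlim (Filter.eventually_of_mem
      (Ioo_mem_nhdsLT (one_pos (α := ℝ))) fun t ht => (P.posDef_iff _).mpr fun j => ?_)
    rw [mul_assoc, ← div_eq_inv_mul]
    by_cases hj : j = i
    · rw [hj, div_self (hP.eig_ne_zero i), mul_one]
      exact sub_pos.mpr ht.2
    · nlinarith [hi j hj, ht.1, ht.2, mul_pos ht.1 (sub_pos.mpr (hi j hj))]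
  · intro h
    have h' : (P.eig i)⁻¹ ∈ masterSpec q := interior_subset h
    have := (P.posDef_iff _).mp h' i
    rw [inv_mul_cancel₀ (hP.eig_ne_zero i), sub_self] at this
    exact this.false

lemma Regular.exists_isExtreme (hP : P.Regular) (hV : (realV q).Nonempty) :
    ∃ i, P.IsExtreme i := by
  obtain ⟨k, hk⟩ := hP.exists_pos hV
  have : Nonempty (Fin n) := ⟨k⟩
  obtain ⟨i, hi⟩ := Finite.exists_max fun j => P.eig j / P.level
  exact ⟨i, hP.isExtreme_of_forall_le (hk.trans_le (hi k)) hi⟩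

/-- Since `core i` is relatively open in its real hyperplane, a polynomial that vanishes on it
vanishes on the complex hyperplane. -/
lemma aeval_eq_zero_of_core {K : Type*} [Field K] [Algebra K ℂ] {i : Fin n}
    (hne : (P.core i).Nonempty) {p : MvPolynomial (Fin n) K}
    (hp : ∀ s ∈ complexify (P.core i), MvPolynomial.aeval s p = 0) {z : Fin n → ℂ}
    (hz : P.complex.coord z i = 0) : MvPolynomial.aeval z p = 0 := by
  have hinj : Function.Injective fun t : ℝ => (t : ℂ) := Complex.ofReal_injective
  have hreal : ∀ u : EuclideanSpace ℝ (Fin n), P.coord u.ofLp i = 0 →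
      MvPolynomial.aeval (fun j => (u j : ℂ)) p = 0 := by
    intro u hu
    obtain ⟨v, hv0, hv⟩ := hne
    obtain ⟨f, hf⟩ := exists_polynomial_eval_line p (fun j => (v j : ℂ))
      ((fun j => (u j : ℂ)) - fun j => (v j : ℂ))
    have hcont : Continuous fun t : ℝ => v + t • (u - v) := by fun_prop
    have hlim := ((P.continuous_slack i).comp hcont).tendsto 0
    simp only [Function.comp_apply, zero_smul, add_zero] at hlim
    have hnhds : {t : ℝ | 0 < P.slack i (P.coord (v + t • (u - v)).ofLp)} ∈ 𝓝 0 :=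
      hlim.eventually (lt_mem_nhds hv)
    have hf0 : f = 0 := by
      refine Polynomial.eq_zero_of_infinite_isRoot f
        (((infinite_of_mem_nhds 0 hnhds).image hinj.injOn).mono ?_)
      rintro _ ⟨t, ht, rfl⟩
      rw [Set.mem_ofPred_eq, Polynomial.IsRoot, hf]
      refine hp _ ⟨v + t • (u - v), ⟨?_, ht⟩, ?_⟩
      · rw [coord_apply] at hu hv0 ⊢
        simp only [WithLp.ofLp_add, WithLp.ofLp_smul, WithLp.ofLp_sub, dotProduct_add,
          dotProduct_smul, dotProduct_sub, smul_eq_mul]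
        linear_combination t * hu + (1 - t) * hv0
      · ext j
        simp
    have := hf 1
    rwa [hf0, Polynomial.eval_zero, one_smul, add_sub_cancel, eq_comm] at this
  -- the real points of the line through `re z` in direction `im z` determine the value at `z`
  obtain ⟨f, hf⟩ := exists_polynomial_eval_line p (fun j => ((z j).re : ℂ))
    (fun j => ((z j).im : ℂ))
  have hzc := (mem_complexHyp_iff i z).mpr hz
  rw [complexHyp, Set.mem_ofPred_eq, dotProduct] at hzc
  have hre := congrArg Complex.re hzc
  have him := congrArg Complex.im hzc
  simp only [Complex.re_sum, Complex.im_sum, Complex.re_ofReal_mul, Complex.im_ofReal_mul,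
    Complex.ofReal_re, Complex.ofReal_im] at hre him
  have hf0 : f = 0 := by
    refine Polynomial.eq_zero_of_infinite_isRoot f
      ((Set.infinite_range_of_injective hinj).mono ?_)
    rintro _ ⟨t, rfl⟩
    rw [Set.mem_ofPred_eq, Polynomial.IsRoot, hf]
    have := hreal (WithLp.toLp 2 fun j => (z j).re + t * (z j).im) (by
      rw [coord_apply]
      simp only [dotProduct, mul_add, Finset.sum_add_distrib, mul_left_comm _ t,
        ← Finset.mul_sum, him, hre]
      simp)
    rw [← this]
    congr 2
    ext j
    simp
  have := hf Complex.I
  rw [hf0, Polynomial.eval_zero] at this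
  rw [this]
  congr 2
  ext j
  simp [mul_comm Complex.I, Complex.re_add_im]

end Real

end PrincipalAxes

/-! ### Algebraic boundaries -/

section AlgebraicBoundary

variable {n : ℕ}

/-- The coefficients of `f` as elements of the field that they generate. -/
def coeffsInField (q : Coeffs n ℝ) : Coeffs n (coeffField q) :=
  fun e => ⟨toComplex q e, Subfield.subset_closure ⟨e, rfl⟩⟩

lemma algebraMap_comp_coeffsInField (q : Coeffs n ℝ) :
    algebraMap (coeffField q) ℂ ∘ coeffsInField q = toComplex q := rfl

lemma masterAlgBoundary_subset_detLocus {q : Coeffs n ℝ} (P : PrincipalAxes q) :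
    masterAlgBoundary q ⊆ detLocus q := by
  intro z hz
  let M : Matrix (Fin n) (Fin n) (Polynomial (coeffField q)) :=
    1 - (Polynomial.X : Polynomial (coeffField q)) • (matA (coeffsInField q)).map Polynomial.C
  have hM : ∀ l : ℂ, Polynomial.aeval l M.det =
      ((1 : Matrix (Fin n) (Fin n) ℂ) - l • matA (toComplex q)).det := by
    intro l
    rw [AlgHom.map_det]
    congr 1
    ext i j
    simp only [M, AlgHom.mapMatrix_apply, Matrix.map_apply, Matrix.sub_apply, Matrix.smul_apply,
      smul_eq_mul, map_sub, map_mul, Polynomial.aeval_X, Polynomial.aeval_C, Matrix.one_apply]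
    rw [apply_ite (Polynomial.aeval l), map_one, map_zero]
    rfl
  have := hz M.det fun l hl => by
    rw [hM]
    exact P.mem_detLocus_of_mem_frontier hl
  rwa [hM] at this

/-- The Krylov determinant of the vector `a + A u` is a polynomial in `u`, with coefficients in the
field generated by the coefficients of `f`, whose zero set is the union of the hyperplanes. -/
lemma PrincipalAxes.Regular.algBoundary_subset {q : Coeffs n ℝ} {P : PrincipalAxes q}
    (hP : P.Regular) (hV : (realV q).Nonempty) :
    algBoundary q ⊆ ⋃ i, complexHyp (P.axes i) (P.axes i ⬝ᵥ P.center) := by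
  intro z hz
  let p : MvPolynomial (Fin n) (coeffField q) :=
    (krylov (matA (MvPolynomial.C ∘ coeffsInField q))
      (halfGrad (MvPolynomial.C ∘ coeffsInField q) MvPolynomial.X)).det
  have hp : ∀ w : Fin n → ℂ, MvPolynomial.aeval w p = 0 ↔ ∃ i, P.complex.coord w i = 0 := by
    intro w
    have h1 : MvPolynomial.aeval w p =
        (krylov (matA (toComplex q)) (halfGrad (toComplex q) w)).det := by
      have hq : (MvPolynomial.aeval w : MvPolynomial (Fin n) (coeffField q) →ₐ[_] ℂ).toRingHom ∘
          (MvPolynomial.C ∘ coeffsInField q) = toComplex q := by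
        ext e
        simp [coeffsInField, toComplex]
        rfl
      have hw : (MvPolynomial.aeval w : MvPolynomial (Fin n) (coeffField q) →ₐ[_] ℂ).toRingHom ∘
          MvPolynomial.X = w := by
        ext j
        simp
      rw [← hq, matA_comp]
      nth_rw 4 [← hw]
      rw [halfGrad_comp, krylov_map, ← RingHom.mapMatrix_apply, ← RingHom.map_det]
      rfl
    have h2 := P.complex.det_krylov_ne_zero_iff (halfGrad (toComplex q) w)
    rw [← not_iff_not, h1, ← Ne, h2, P.complex.axes_mulVec_halfGrad]
    simp [hP.complex.eig_injective, hP.complex.eig_ne_zero]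
  have h := (hp z).mp (hz p ?_)
  · obtain ⟨i, hi⟩ := h
    exact Set.mem_iUnion.mpr ⟨i, (PrincipalAxes.mem_complexHyp_iff i z).mpr hi⟩
  · rintro _ ⟨u, hu, rfl⟩
    rw [hP.frontier_edRegion hV, hP.compl_edRegion hV] at hu
    obtain ⟨i, hi⟩ := Set.mem_iUnion.mp hu
    exact (hp _).mpr ⟨i, by rw [PrincipalAxes.coord_complexify, hi.1, Complex.ofReal_zero]⟩

end AlgebraicBoundary

/-! ### Irreducibility of the generic characteristic polynomial -/

section Arrow

variable {R : Type*} [CommRing R] {m : ℕ}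

/-- The matrix with nonzero entries only on the diagonal and in the first row and column. -/
def arrow (x : R) (u v D : Fin m → R) : Matrix (Fin (m + 1)) (Fin (m + 1)) R :=
  Matrix.of (Fin.cons (Fin.cons x u : Fin (m + 1) → R)
    fun i => (Fin.cons (v i) (Matrix.diagonal D i) : Fin (m + 1) → R))

lemma det_arrow [IsDomain R] (x : R) (u v D : Fin m → R) (hD : ∀ i, D i ≠ 0) :
    (arrow x u v D).det =
      x * ∏ i, D i - ∑ i, u i * v i * ∏ j ∈ Finset.univ.erase i, D j := by
  -- clear the first column below the diagonal
  let L : Matrix (Fin (m + 1)) (Fin (m + 1)) R :=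
    arrow (∏ i, D i) 0 (fun i => -(v i * ∏ j ∈ Finset.univ.erase i, D j)) 1
  have hL : L.det = ∏ i, D i := by
    rw [Matrix.det_of_isLowerTriangular, Fin.prod_univ_succ]
    · simp [L, arrow]
    · intro i j hij
      induction i using Fin.cases with
      | zero =>
        induction j using Fin.cases with
        | zero => exact absurd hij (lt_irrefl _)
        | succ j => simp [L, arrow]
      | succ i =>
        induction j using Fin.cases with
        | zero => exact absurd (OrderDual.toDual_lt_toDual.mp hij) (Fin.not_lt_zero _)
        | succ j =>
          have : i ≠ j := by
            rintro rfl
            exact absurd hij (lt_irrefl _)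
          simp [L, arrow, this]
  have h00 : (arrow x u v D * L) 0 0 =
      x * ∏ i, D i - ∑ i, u i * v i * ∏ j ∈ Finset.univ.erase i, D j := by
    simp [Matrix.mul_apply, Fin.sum_univ_succ, L, arrow, sub_eq_add_neg, mul_assoc]
  have hs0 : ∀ i : Fin m, (arrow x u v D * L) i.succ 0 = 0 := by
    intro i
    simp only [Matrix.mul_apply, Fin.sum_univ_succ, L, arrow, Matrix.of_apply, Fin.cons_succ,
      Fin.cons_zero]
    rw [Finset.sum_eq_single_of_mem i (Finset.mem_univ i) fun j _ hj => by
      rw [Matrix.diagonal_apply_ne _ hj.symm, zero_mul], Matrix.diagonal_apply_eq,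
      ← Finset.mul_prod_erase _ _ (Finset.mem_univ i)]
    ring
  have hss : ∀ i j : Fin m, (arrow x u v D * L) i.succ j.succ = Matrix.diagonal D i j := by
    intro i j
    simp only [Matrix.mul_apply, Fin.sum_univ_succ, L, arrow, Matrix.of_apply, Fin.cons_succ,
      Fin.cons_zero, Pi.zero_apply, mul_zero, zero_add]
    rw [← Matrix.mul_apply]
    change (Matrix.diagonal D * Matrix.diagonal fun _ => 1 : Matrix (Fin m) (Fin m) R) i j = _
    rw [Matrix.diagonal_one, Matrix.mul_one]
  have hNL : (arrow x u v D * L).det =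
      (x * ∏ i, D i - ∑ i, u i * v i * ∏ j ∈ Finset.univ.erase i, D j) * ∏ i, D i := by
    rw [Matrix.det_of_isUpperTriangular, Fin.prod_univ_succ, h00]
    · simp only [hss, Matrix.diagonal_apply_eq]
    · intro i j hij
      induction i using Fin.cases with
      | zero => exact absurd hij (by simp)
      | succ i =>
        induction j using Fin.cases with
        | zero => exact hs0 i
        | succ j =>
          rw [hss]
          exact Matrix.diagonal_apply_ne _ (by rintro rfl; exact absurd hij (lt_irrefl _))
  rw [Matrix.det_mul, hL] at hNL
  exact mul_right_cancel₀ (Finset.prod_ne_zero_iff.mpr fun i _ => hD i) hNL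

end Arrow

section Irreducibility

open Polynomial

lemma isCoprime_X_sub_C_of_eval_ne_zero {K : Type*} [Field K] {a : K} {f : K[X]}
    (h : f.eval a ≠ 0) : IsCoprime (X - C a) f :=
  (irreducible_X_sub_C a).coprime_iff_not_dvd.mpr fun hd => h (dvd_iff_isRoot.mp hd)

/-- An arrow matrix over `ℚ[b]` with the indeterminate `b` in the corner. -/
noncomputable def arrowMatrix (m : ℕ) : Matrix (Fin (m + 1)) (Fin (m + 1)) ℚ[X] :=
  arrow X 1 1 fun i => C (i : ℚ)

/-- The characteristic polynomial has degree one in the indeterminate `b`, and its two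
coefficients are coprime. -/
lemma irreducible_charpoly_arrowMatrix (m : ℕ) : Irreducible (arrowMatrix m).charpoly := by
  have hchar : (arrowMatrix m).charmatrix =
      arrow (X - C X) (-1) (-1) fun i => (X - C (C (i : ℚ)) : ℚ[X][X]) := by
    ext1 i j
    induction i using Fin.cases with
    | zero =>
      induction j using Fin.cases <;>
        simp [arrowMatrix, arrow, (Fin.succ_ne_zero _).symm]
    | succ i =>
      induction j using Fin.cases with
      | zero => simp [arrowMatrix, arrow]
      | succ j =>
        by_cases h : i = j <;>
          simp [arrowMatrix, arrow, h]
  set D : ℚ[X] := ∏ i : Fin m, (X - C (i : ℚ)) with hD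
  set E : ℚ[X] := X * D - ∑ i : Fin m, ∏ j ∈ Finset.univ.erase i, (X - C (j : ℚ)) with hE
  have hswap : Bivariate.swap (arrowMatrix m).charpoly = C (-D) * X + C E := by
    rw [Matrix.charpoly, hchar, det_arrow _ _ _ _ fun i => X_sub_C_ne_zero _]
    simp only [map_sub, map_mul, map_prod, map_sum, Bivariate.swap_X, Bivariate.swap_Y,
      Bivariate.swap_C_C, Pi.neg_apply, Pi.one_apply, neg_mul_neg, one_mul, hD, hE,
      map_neg]
    ring
  have hcop : IsCoprime D E := by
    refine IsCoprime.prod_left fun k _ => isCoprime_X_sub_C_of_eval_ne_zero ?_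
    have hDk : D.eval (k : ℚ) = 0 := by
      rw [hD, eval_prod]
      exact Finset.prod_eq_zero (Finset.mem_univ k) (by simp)
    rw [hE, eval_sub, eval_mul, hDk, mul_zero, zero_sub, neg_ne_zero, eval_finsetSum,
      Finset.sum_eq_single_of_mem k (Finset.mem_univ k), eval_prod, Finset.prod_ne_zero_iff]
    · intro j hj
      simpa [sub_eq_zero, Fin.val_inj] using (Finset.ne_of_mem_erase hj).symm
    · intro i _ hi
      rw [eval_prod]
      exact Finset.prod_eq_zero (Finset.mem_erase.mpr ⟨hi.symm, Finset.mem_univ k⟩) (by simp)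
  have hirr : Irreducible (C (-D) * X + C E) := by
    refine irreducible_C_mul_X_add_C ?_ hcop.neg_left.isRelPrime
    exact neg_ne_zero.mpr (Finset.prod_ne_zero_iff.mpr fun i _ => X_sub_C_ne_zero _)
  rw [← hswap] at hirr
  exact (MulEquiv.irreducible_iff (Bivariate.swap (R := ℚ))).mp hirr

/-- The characteristic polynomial of the generic symmetric matrix is irreducible, since that of
one of its specializations is. -/
lemma irreducible_charpoly_generic (n : ℕ) (hn : 1 ≤ n) :
    Irreducible
      (matA (MvPolynomial.X : Coeffs n (MvPolynomial (Sym2 (Fin (n + 1))) ℚ))).charpoly := by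
  obtain ⟨m, rfl⟩ := Nat.exists_eq_add_of_le' hn
  have hsymm : (arrowMatrix m).IsSymm := by
    refine Matrix.IsSymm.ext fun i j => ?_
    induction i using Fin.cases with
    | zero => induction j using Fin.cases <;> simp [arrowMatrix, arrow]
    | succ i =>
      induction j using Fin.cases with
      | zero => simp [arrowMatrix, arrow]
      | succ j =>
        by_cases h : i = j
        · rw [h]
        · simp [arrowMatrix, arrow, h, Ne.symm h]
  let φ : MvPolynomial (Sym2 (Fin (m + 1 + 1))) ℚ →ₐ[ℚ] ℚ[X] :=
    MvPolynomial.aeval (ofParts (arrowMatrix m) hsymm 0 0)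
  refine (Matrix.charpoly_monic _).irreducible_of_irreducible_map φ.toRingHom _ ?_
  have hφ : φ.toRingHom ∘ MvPolynomial.X = ofParts (arrowMatrix m) hsymm 0 0 := by
    ext e
    simp [φ]
  rw [← Matrix.charpoly_map, ← matA_comp, hφ, matA_ofParts]
  exact irreducible_charpoly_arrowMatrix m

/-- For algebraically independent coefficients, the characteristic polynomial is irreducible over
the field that they generate, by Gauss's lemma. -/
lemma irreducible_charpoly_coeffsInField {n : ℕ} (hn : 1 ≤ n) {q : Coeffs n ℝ}
    (hq : AlgebraicIndependent ℚ q) : Irreducible (matA (coeffsInField q)).charpoly := by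
  let φ : MvPolynomial (Sym2 (Fin (n + 1))) ℚ →ₐ[ℚ] coeffField q :=
    MvPolynomial.aeval (coeffsInField q)
  have hφ : φ.toRingHom ∘ MvPolynomial.X = coeffsInField q := by
    ext e
    simp [φ]
  have hcomp : ∀ p, (φ p : ℂ) = ((MvPolynomial.aeval q p : ℝ) : ℂ) := by
    intro p
    have h1 : (φ p : ℂ) = MvPolynomial.aeval (toComplex q) p := by
      change ((algebraMap (coeffField q) ℂ).toRatAlgHom.comp φ) p = _
      rw [MvPolynomial.comp_aeval]
      rfl
    have h2 : ((MvPolynomial.aeval q p : ℝ) : ℂ) = MvPolynomial.aeval (toComplex q) p := by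
      change (Complex.ofRealHom.toRatAlgHom.comp (MvPolynomial.aeval q)) p = _
      rw [MvPolynomial.comp_aeval]
      rfl
    rw [h1, h2]
  have hinj : Function.Injective φ := by
    rw [injective_iff_map_eq_zero]
    intro p hp
    have h := hcomp p
    rw [hp] at h
    refine (injective_iff_map_eq_zero _).mp hq p ?_
    exact Complex.ofReal_eq_zero.mp h.symm
  let : Algebra (MvPolynomial (Sym2 (Fin (n + 1))) ℚ) (coeffField q) := φ.toRingHom.toAlgebra
  have : FaithfulSMul (MvPolynomial (Sym2 (Fin (n + 1))) ℚ) (coeffField q) :=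
    (faithfulSMul_iff_algebraMap_injective _ _).mpr hinj
  have hsub : ∀ y ∈ Subring.closure (Set.range (toComplex q)), ∃ p, (φ p : ℂ) = y := by
    have hle : Subring.closure (Set.range (toComplex q)) ≤
        ((coeffField q).subtype.comp φ.toRingHom).range := by
      rw [Subring.closure_le]
      rintro _ ⟨e, rfl⟩
      exact ⟨MvPolynomial.X e, by simp [φ, coeffsInField]⟩
    exact fun y hy => hle hy
  have : IsFractionRing (MvPolynomial (Sym2 (Fin (n + 1))) ℚ) (coeffField q) := by
    refine IsFractionRing.of_field _ _ fun z => ?_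
    obtain ⟨y, hy, w, hw, hyw⟩ := Subfield.mem_closure_iff.mp z.2
    obtain ⟨p, hp⟩ := hsub y hy
    obtain ⟨r, hr⟩ := hsub w hw
    refine ⟨p, r, Subtype.ext ?_⟩
    rw [← hyw, ← hp, ← hr]
    rfl
  have h := (Matrix.charpoly_monic (matA (MvPolynomial.X :
    Coeffs n (MvPolynomial (Sym2 (Fin (n + 1))) ℚ)))).irreducible_iff_irreducible_map_fraction_map
    (K := coeffField q) |>.mp (irreducible_charpoly_generic n hn)
  rw [← Matrix.charpoly_map] at h
  rw [← hφ, matA_comp]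
  exact h

namespace PrincipalAxes

variable {n : ℕ} {q : Coeffs n ℝ} {P : PrincipalAxes q}

/-- For algebraically independent coefficients all eigenvalues are conjugate over the field of
coefficients. -/
lemma Regular.aeval_inv_eig_eq_zero (hP : P.Regular) (hn : 1 ≤ n) (hq : AlgebraicIndependent ℚ q)
    {f : (coeffField q)[X]} {i : Fin n} (hi : aeval (P.complex.eig i)⁻¹ f = 0) (k : Fin n) :
    aeval (P.complex.eig k)⁻¹ f = 0 := by
  have hroot : ∀ j, aeval (P.complex.eig j) (matA (coeffsInField q)).charpoly = 0 := by
    intro j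
    have hj := hP.complex.eig_ne_zero j
    rw [aeval_def, ← eval_map, ← Matrix.charpoly_map, ← matA_comp, algebraMap_comp_coeffsInField,
      Matrix.eval_charpoly]
    have h : Matrix.scalar (Fin n) (P.complex.eig j) - matA (toComplex q) =
        P.complex.eig j • (1 - (P.complex.eig j)⁻¹ • matA (toComplex q)) := by
      rw [smul_sub, smul_smul, mul_inv_cancel₀ hj, one_smul, Matrix.scalar_apply,
        Matrix.smul_one_eq_diagonal]
    rw [h, Matrix.det_smul, P.complex.det_hessian,
      Finset.prod_eq_zero (Finset.mem_univ j) (by rw [inv_mul_cancel₀ hj, sub_self]), mul_zero]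
  have hrev : ∀ j, aeval (P.complex.eig j)⁻¹ f = 0 ↔ aeval (P.complex.eig j) f.reverse = 0 := by
    intro j
    have hj := inv_ne_zero (hP.complex.eig_ne_zero j)
    let := invertibleOfNonzero hj
    rw [aeval_def, aeval_def, ← eval₂_reverse_eq_zero_iff, invOf_eq_inv, inv_inv]
  have hmin : ∀ j, minpoly (coeffField q) (P.complex.eig j) = (matA (coeffsInField q)).charpoly :=
    fun j => (minpoly.eq_of_irreducible_of_monic
      (irreducible_charpoly_coeffsInField hn hq) (hroot j) (Matrix.charpoly_monic _)).symm
  rw [hrev] at hi ⊢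
  rw [← minpoly.dvd_iff, hmin k, ← hmin i]
  exact minpoly.dvd _ _ hi

theorem Regular.masterAlgBoundary_eq (hP : P.Regular) (hV : (realV q).Nonempty) (hn : 1 ≤ n)
    (hq : AlgebraicIndependent ℚ q) : masterAlgBoundary q = detLocus q := by
  refine subset_antisymm (masterAlgBoundary_subset_detLocus P) fun z hz p hp => ?_
  obtain ⟨k, rfl⟩ := (hP.complex.mem_detLocus_iff z).mp hz
  obtain ⟨i, hi⟩ := hP.exists_isExtreme hV
  refine hP.aeval_inv_eig_eq_zero hn hq (i := i) ?_ k
  have := hp _ (hP.inv_eig_mem_frontier hi)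
  rwa [Complex.ofReal_inv] at this

/-- A polynomial over the field of coefficients that vanishes on one of the hyperplanes vanishes
at the points `y - l (a + A y)` with `l = 1 / eigᵢ`; for `y` over this field, it then vanishes
for the conjugate multipliers as well, that is, on the other hyperplanes. -/
theorem Regular.algBoundary_eq (hP : P.Regular) (hV : (realV q).Nonempty) (hn : 1 ≤ n)
    (hq : AlgebraicIndependent ℚ q) :
    algBoundary q = ⋃ i, complexHyp (P.axes i) (P.axes i ⬝ᵥ P.center) := by
  refine subset_antisymm (hP.algBoundary_subset hV) fun z hz p hp => ?_
  obtain ⟨k, hk⟩ := Set.mem_iUnion.mp hz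
  rw [mem_complexHyp_iff, ← hP.complex.image_piMap_singleton] at hk
  obtain ⟨x, -, rfl⟩ := hk
  obtain ⟨i, hi⟩ := hP.exists_isExtreme hV
  have hvan : ∀ w : Fin n → ℂ, P.complex.coord w i = 0 → MvPolynomial.aeval w p = 0 := by
    refine fun w => aeval_eq_zero_of_core (hP.core_nonempty hV i) fun s hs => hp s ?_
    obtain ⟨u, hu, rfl⟩ := hs
    refine ⟨u, ?_, rfl⟩
    rw [hP.frontier_edRegion hV, hP.compl_edRegion hV]
    exact Set.mem_iUnion.mpr ⟨⟨i, hi⟩, core_subset_piece i hu⟩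
  have hfield : ∀ y : Fin n → coeffField q,
      MvPolynomial.aeval (piMap q (algebraMap _ ℂ ∘ y, (P.complex.eig k)⁻¹)) p = 0 := by
    intro y
    let f : (coeffField q)[X] :=
      MvPolynomial.aeval (fun j => C (y j) - X * C (halfGrad (coeffsInField q) y j)) p
    have hf : ∀ l : ℂ, aeval l f = MvPolynomial.aeval (piMap q (algebraMap _ ℂ ∘ y, l)) p := by
      intro l
      rw [← AlgHom.comp_apply, MvPolynomial.comp_aeval]
      congr 2
      ext j
      rw [piMap, ← algebraMap_comp_coeffsInField, halfGrad_comp]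
      simp
      exact mul_comm _ _
    rw [← hf]
    refine hP.aeval_inv_eig_eq_zero hn hq (i := i) ?_ k
    rw [hf]
    refine hvan _ ?_
    rw [piMap, P.complex.coord_sub_smul_halfGrad, inv_mul_cancel₀ (hP.complex.eig_ne_zero i),
      sub_self, zero_mul]
  let l : ℂ := (P.complex.eig k)⁻¹
  let G : MvPolynomial (Fin n) ℂ := MvPolynomial.aeval
    (fun j => MvPolynomial.X j - MvPolynomial.C l *
      halfGrad (MvPolynomial.C ∘ toComplex q) MvPolynomial.X j) p
  have hG : ∀ y : Fin n → ℂ, MvPolynomial.eval y G = MvPolynomial.aeval (piMap q (y, l)) p := by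
    intro y
    rw [← MvPolynomial.aeval_eq_eval, ← AlgHom.restrictScalars_apply (coeffField q),
      ← AlgHom.comp_apply, MvPolynomial.comp_aeval]
    congr 2
    ext j
    have hy : (MvPolynomial.eval y) ∘ (MvPolynomial.X : Fin n → MvPolynomial (Fin n) ℂ) = y := by
      ext j
      simp
    have hc : (MvPolynomial.eval y) ∘ (MvPolynomial.C ∘ toComplex q) = toComplex q := by
      ext e
      simp
    have h := congrFun (halfGrad_comp (MvPolynomial.eval y) (MvPolynomial.C ∘ toComplex q)
      (MvPolynomial.X : Fin n → MvPolynomial (Fin n) ℂ)) j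
    rw [hc, hy] at h
    simp [piMap, h, MvPolynomial.aeval_eq_eval]
  have hG0 : G = 0 := by
    refine MvPolynomial.funext_set (fun _ => Set.range (algebraMap (coeffField q) ℂ))
      (fun _ => Set.infinite_range_of_injective (algebraMap (coeffField q) ℂ).injective)
      fun y hy => ?_
    choose y' hy' using fun j => hy j (Set.mem_univ j)
    have : y = algebraMap _ ℂ ∘ y' := funext fun j => (hy' j).symm
    rw [hG, map_zero, this]
    exact hfield y'
  have := hG x
  rw [hG0, map_zero] at this
  exact this.symm

end PrincipalAxes

end Irreducibility

/-! ### Genericity -/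

section Generic

variable {n : ℕ} {R S : Type*} [CommRing R] [CommRing S]

/-- The symmetric matrix `[[α, aᵀ], [a, A]]` of all coefficients. -/
def fullMatrix (q : Coeffs n R) : Matrix (Fin (n + 1)) (Fin (n + 1)) R :=
  Matrix.of fun i j => q s(i, j)

/-- The product of three determinants: that of `A`, which does not vanish if the quadric has a
centre, that of the full matrix, which does not vanish if the quadric is nonsingular, and the
Krylov determinant of the vector of ones, which vanishes if `A` has a multiple eigenvalue. -/
def genericity (q : Coeffs n R) : R :=
  (matA q).det * (fullMatrix q).det * (krylov (matA q) 1).det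

lemma genericity_comp (φ : R →+* S) (q : Coeffs n R) : genericity (φ ∘ q) = φ (genericity q) := by
  have h1 : φ ∘ (1 : Fin n → R) = 1 := by
    ext
    simp
  have h2 : fullMatrix (φ ∘ q) = (fullMatrix q).map φ := rfl
  rw [genericity, genericity, ← h1, matA_comp, h2, krylov_map, map_mul, map_mul, RingHom.map_det,
    RingHom.map_det, RingHom.map_det]
  rfl

/-- The genericity condition as a polynomial in the coefficients. -/
noncomputable def genericityPoly (n : ℕ) : MvPolynomial (Sym2 (Fin (n + 1))) ℚ :=
  genericity MvPolynomial.X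

lemma aeval_genericityPoly {K : Type*} [Field K] [Algebra ℚ K] (q : Coeffs n K) :
    MvPolynomial.aeval q (genericityPoly n) = genericity q := by
  have h := genericity_comp (MvPolynomial.aeval q : MvPolynomial _ ℚ →ₐ[ℚ] K).toRingHom
    (MvPolynomial.X : Coeffs n (MvPolynomial (Sym2 (Fin (n + 1))) ℚ))
  have hq : (MvPolynomial.aeval q : MvPolynomial _ ℚ →ₐ[ℚ] K).toRingHom ∘ MvPolynomial.X = q := by
    ext e
    simp
  rw [hq] at h
  exact h.symm

/-- Witness: `f = ∑ (i + 1) xᵢ² - 1`. -/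
lemma genericityPoly_ne_zero (n : ℕ) : genericityPoly n ≠ 0 := by
  let d : Fin n → ℚ := fun i => (i : ℚ) + 1
  have hd : ∀ i, d i ≠ 0 := fun i => by positivity
  let q : Coeffs n ℚ := ofParts (Matrix.diagonal d) (Matrix.isSymm_diagonal d) 0 (-1)
  have hA : matA q = Matrix.diagonal d := matA_ofParts _ _ _ _
  let P : PrincipalAxes q :=
    { axes := 1
      eig := d
      center := 0
      axes_mul_transpose := by simp
      axes_mul_matA := by rw [hA, Matrix.one_mul, Matrix.mul_one]
      halfGrad_center := by simp [halfGrad, q, vecA_ofParts] }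
  intro h0
  have h := aeval_genericityPoly q
  rw [h0, map_zero, genericity, eq_comm, mul_eq_zero, mul_eq_zero] at h
  rcases h with (h | h) | h
  · rw [hA, Matrix.det_diagonal, Finset.prod_eq_zero_iff] at h
    obtain ⟨i, -, hi⟩ := h
    exact hd i hi
  · have hfull : fullMatrix q = Matrix.diagonal (Fin.cons (-1) d) := by
      ext i j
      induction i using Fin.cases with
      | zero =>
        induction j using Fin.cases <;>
          simp [fullMatrix, q, ofParts, (Fin.succ_ne_zero _).symm]
      | succ i =>
        induction j using Fin.cases with
        | zero => simp [fullMatrix, q, ofParts]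
        | succ j => by_cases h : i = j <;> simp [fullMatrix, q, ofParts, h]
    rw [hfull, Matrix.det_diagonal, Finset.prod_eq_zero_iff] at h
    obtain ⟨i, -, hi⟩ := h
    induction i using Fin.cases with
    | zero => simp at hi
    | succ i => exact hd i (by simpa using hi)
  · refine (P.det_krylov_ne_zero_iff 1).mpr ⟨fun i => ?_, fun i j hij => ?_⟩ h
    · simp [P]
    · exact Fin.ext (by exact_mod_cast add_right_cancel hij)

end Generic

/-- A real quadric satisfying the genericity condition has principal axes: the spectral theorem
provides the axes, and the centre exists since `A` is invertible. -/
lemma exists_principalAxes_regular {n : ℕ} {q : Coeffs n ℝ} (hq : genericity q ≠ 0) :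
    ∃ P : PrincipalAxes q, P.Regular := by
  rw [genericity, mul_ne_zero_iff, mul_ne_zero_iff] at hq
  obtain ⟨⟨hA, hfull⟩, hkry⟩ := hq
  have hherm : (matA q).IsHermitian := by
    rw [Matrix.IsHermitian, Matrix.conjTranspose_eq_transpose_of_trivial, matA_transpose]
  have hunit : IsUnit (matA q).det := hA.isUnit
  have hU : (hherm.eigenvectorUnitary : Matrix (Fin n) (Fin n) ℝ)ᵀ *
      (hherm.eigenvectorUnitary : Matrix (Fin n) (Fin n) ℝ) = 1 := by
    have := Unitary.coe_star_mul_self hherm.eigenvectorUnitary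
    rwa [Matrix.star_eq_conjTranspose, Matrix.conjTranspose_eq_transpose_of_trivial] at this
  let P : PrincipalAxes q :=
    { axes := (hherm.eigenvectorUnitary : Matrix (Fin n) (Fin n) ℝ)ᵀ
      eig := hherm.eigenvalues
      center := -((matA q)⁻¹ *ᵥ vecA q)
      axes_mul_transpose := by rw [Matrix.transpose_transpose, hU]
      axes_mul_matA := by
        refine (congrArg ((hherm.eigenvectorUnitary : Matrix (Fin n) (Fin n) ℝ)ᵀ * ·)
          hherm.spectral_theorem).trans ?_
        rw [Unitary.conjStarAlgAut_apply, Matrix.star_eq_conjTranspose,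
          Matrix.conjTranspose_eq_transpose_of_trivial, ← Matrix.mul_assoc, ← Matrix.mul_assoc, hU,
          Matrix.one_mul]
        rfl
      halfGrad_center := by
        rw [halfGrad, Matrix.mulVec_neg, Matrix.mulVec_mulVec, Matrix.mul_nonsing_inv _ hunit,
          Matrix.one_mulVec, add_neg_cancel] }
  refine ⟨P, ((P.det_krylov_ne_zero_iff 1).mp hkry).2, fun i hi => ?_, fun h => ?_⟩
  · rw [P.det_matA] at hA
    exact hA (Finset.prod_eq_zero (Finset.mem_univ i) hi)
  · -- a centre on the quadric is in the kernel of the full matrix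
    refine hfull (Matrix.exists_mulVec_eq_zero_iff.mp
      ⟨(Fin.cons 1 P.center : Fin (n + 1) → ℝ), fun h0 => ?_, ?_⟩)
    · simpa using congrFun h0 0
    · have hg : ∀ i, vecA q i + (matA q *ᵥ P.center) i = 0 := congrFun P.halfGrad_center
      have hquad : vecA q ⬝ᵥ P.center + q s(0, 0) = 0 := by
        have h1 : matA q *ᵥ P.center = -vecA q := by
          ext i
          have := hg i
          rw [Pi.neg_apply]
          linarith
        have h2 : quad q P.center = 0 := neg_eq_zero.mp h
        rw [quad, h1, dotProduct_neg, dotProduct_comm] at h2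
        linarith
      ext i
      induction i using Fin.cases with
      | zero =>
        rw [Matrix.mulVec, dotProduct, Fin.sum_univ_succ]
        simp only [fullMatrix, Matrix.of_apply, Fin.cons_zero, Fin.cons_succ, mul_one,
          Pi.zero_apply]
        rw [add_comm]
        exact hquad
      | succ i =>
        rw [Matrix.mulVec, dotProduct, Fin.sum_univ_succ]
        simp only [fullMatrix, Matrix.of_apply, Fin.cons_zero, Fin.cons_succ, mul_one,
          Pi.zero_apply]
        rw [Sym2.eq_swap]
        exact hg i

end EDQuadric

theorem proposition5p6 (n : ℕ) (hn : 1 ≤ n) :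
    (∀ q : EDQuadric.Coeffs n ℝ,
      (∃ x ∈ EDQuadric.realV q, EDQuadric.halfGrad q x.ofLp ≠ 0) →
        Dense (EDQuadric.edRegion q)) ∧
    ∃ P : MvPolynomial (Sym2 (Fin (n + 1))) ℚ, P ≠ 0 ∧
      ∀ q : EDQuadric.Coeffs n ℝ, MvPolynomial.aeval q P ≠ 0 → (EDQuadric.realV q).Nonempty →
        Dense (EDQuadric.edRegion q) ∧
        frontier (EDQuadric.edRegion q) = (EDQuadric.edRegion q)ᶜ ∧
        EDQuadric.HasDegree (EDQuadric.complexV q ×ˢ EDQuadric.masterAlgBoundary q)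
          (EDQuadric.piMap q) 2 ∧
        EDQuadric.HasDegree (EDQuadric.complexV q ×ˢ EDQuadric.detLocus q)
          (EDQuadric.piMap q) 2 ∧
        (∃ (w : Fin n → Fin n → ℝ) (c : Fin n → ℝ),
          (∀ i, w i ≠ 0) ∧
          Function.Injective (fun i => EDQuadric.realHyp (w i) (c i)) ∧
          EDQuadric.piMap q '' (EDQuadric.complexV q ×ˢ EDQuadric.detLocus q) =
            ⋃ i, EDQuadric.complexHyp (w i) (c i) ∧
          (AlgebraicIndependent ℚ q →
            EDQuadric.masterAlgBoundary q = EDQuadric.detLocus q ∧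
            EDQuadric.algBoundary q = ⋃ i, EDQuadric.complexHyp (w i) (c i)) ∧
          (EDQuadric.IsEllipsoid (EDQuadric.realV q) →
            (∃ i, EDQuadric.IsSolidEllipsoidIn (frontier (EDQuadric.edRegion q))
              (EDQuadric.realHyp (w i) (c i))) ∧
            EDQuadric.cutLocus (EDQuadric.realV q) =
              intrinsicInterior ℝ (frontier (EDQuadric.edRegion q))) ∧
          (¬ EDQuadric.IsEllipsoid (EDQuadric.realV q) →
            ∃ (i j : Fin n) (B₁ B₂ : Set (EuclideanSpace ℝ (Fin n))), i ≠ j ∧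
              frontier (EDQuadric.edRegion q) = B₁ ∪ B₂ ∧ Disjoint B₁ B₂ ∧
              EDQuadric.IsBoundedByQuadricIn B₁ (w i) (c i) ∧
              EDQuadric.IsBoundedByQuadricIn B₂ (w j) (c j) ∧
              EDQuadric.cutLocus (EDQuadric.realV q) =
                intrinsicInterior ℝ B₁ ∪ intrinsicInterior ℝ B₂)) ∧
        frontier (EDQuadric.edRegion q) = closure (EDQuadric.cutLocus (EDQuadric.realV q)) := by
  refine ⟨fun q => EDQuadric.dense_edRegion, EDQuadric.genericityPoly n,
    EDQuadric.genericityPoly_ne_zero n, fun q hq hV => ?_⟩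
  rw [EDQuadric.aeval_genericityPoly] at hq
  obtain ⟨P, hP⟩ := EDQuadric.exists_principalAxes_regular hq
  refine ⟨hP.dense_edRegion hV, hP.frontier_edRegion hV,
    hP.complex.hasDegree_two (EDQuadric.masterAlgBoundary_subset_detLocus P),
    hP.complex.hasDegree_two subset_rfl,
    ⟨fun i => P.axes i, fun i => P.axes i ⬝ᵥ P.center, fun i hi => ?_, P.realHyp_injective,
      hP.image_piMap, fun hind => ⟨hP.masterAlgBoundary_eq hV hn hind,
        hP.algBoundary_eq hV hn hind⟩, hP.ellipsoid_case hV, hP.not_ellipsoid_case hV⟩,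
    (hP.closure_cutLocus hV).symm⟩
  have h := P.axes_dotProduct_axes i i
  rw [show P.axes i = 0 from hi, zero_dotProduct, if_pos rfl] at h
  exact zero_ne_one h
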